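/- **Computational adequacy of the guarded denotational semantics of FPC.** *Language.* FPC has types $\tau ::= \alpha \mid 1 \mid \tau\times\tau \mid \tau+\tau \mid \tau\to\tau \mid \mu\alpha.\tau$ and terms $L,M,N ::= \langle\rangle \mid x \mid \mathsf{inl}\,M \mid \mathsf{inr}\,M \mid \mathsf{case}\,L\,\mathsf{of}\,x_1.M;x_2.N \mid \langle M,N\rangle \mid \mathsf{fst}\,M \mid \mathsf{snd}\,M \mid \lambda x{:}\tau.M \mid M\,N \mid \mathsf{fold}\,M \mid \mathsf{unfold}\,M$, with the standard typing rules $\Gamma\vdash M:\sigma$ (all types in $\Gamma$ and $\sigma$ closed), where $\mathsf{fold}$ takes $\tau[\mu\alpha.\tau/\alpha]$ to $\mu\alpha.\tau$ and $\mathsf{unfold}$ goes back. Values are the closed terms of the forms $\langle\rangle,\ \mathsf{inl}\,M,\ \mathsf{inr}\,M,\ \langle M,N\rangle,\ \lambda x{:}\tau.M,\ \mathsf{fold}\,M$. The call-by-name big-step relation $M\Downarrow^k v$, which counts unfold-fold reductions, is inductively generated by: $v\Downarrow^0 v$ for values $v$; if $L\Downarrow^k\mathsf{inl}\,L'$ and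 $M[L'/x_1]\Downarrow^m v$ then $\mathsf{case}\,L\,\mathsf{of}\,x_1.M;x_2.N\Downarrow^{m+k}v$, and symmetrically for $\mathsf{inr}$; if $L\Downarrow^k\langle M,N\rangle$ and $M\Downarrow^l v$ (resp. $N\Downarrow^l v$) then $\mathsf{fst}\,L\Downarrow^{k+l}v$ (resp. $\mathsf{snd}\,L\Downarrow^{k+l}v$); if $M\Downarrow^k\lambda x{:}\sigma.L$ and $L[N/x]\Downarrow^l v$ then $M\,N\Downarrow^{k+l}v$; if $M\Downarrow^k\mathsf{fold}\,N$ and $N\Downarrow^m v$ then $\mathsf{unfold}\,M\Downarrow^{k+m+1}v$. *Semantics.* Types and terms that depend on one clock $\kappa$ are interpreted in the topos of trees, the category of presheaves of sets on $\omega$: an object $X$ is a sequence $X(0)\leftarrow X(1)\leftarrow\cdots$. Here $(\triangleright X)(0)=1$ and $(\triangleright X)(n+1)=X(n)$; $\mathrm{next}:X\to\triangleright X$ is given by the restriction maps; $\circledast:\triangleright(X\to Y)\times\triangleright X\to\triangleright Y$ is later application; $\forall\kappa.X$ is the set of global elements of $X$; and an identity type $x=y$ is interpreted at stage $n$ as equality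 of the stage-$n$ components of $x$ and $y$. Let $LA$ be the solution of $LA\cong A+\triangleright LA$, with injections $\eta:A\to LA$ and $\theta:\triangleright LA\to LA$. For a map $f:A\to B$ into an object with a map $\theta_B:\triangleright B\to B$, let $\hat f:LA\to B$ be the guarded recursive map with $\hat f(\eta(a))=f(a)$ and $\hat f(\theta(r))=\theta_B(\mathrm{next}(\hat f)\circledast r)$. A type with free type variables in $\Theta$ is interpreted, in an environment $\rho$ of objects, by $[\![\alpha]\!](\rho)=\rho(\alpha)$, $[\![1]\!](\rho)=L1$, $[\![\sigma\times\tau]\!](\rho)=[\![\sigma]\!](\rho)\times[\![\tau]\!](\rho)$, $[\![\sigma+\tau]\!](\rho)=L([\![\sigma]\!](\rho)+[\![\tau]\!](\rho))$, $[\![\sigma\to\tau]\!](\rho)=[\![\sigma]\!](\rho)\to[\![\tau]\!](\rho)$ (exponential), and $[\![\mu\alpha.\tau]\!](\rho)$ is the guarded fixed point $X=\triangleright[\![\tau]\!](\rho,X)$; it follows that $[\![\mu\alpha.\tau]\!]=\triangleright[\![\tau[\mu\alpha.\tau/\alpha]]\!]$ for closed $\mu\alpha.\tau$. Maps $\theta_\tau:\triangleright[\![\tau]\!]\to[\![\tau]\!]$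 for closed $\tau$ are defined by guarded recursion and induction on $\tau$: $\theta_1$ and $\theta_{\sigma+\tau}$ are the maps $\theta$ of $L$; $\theta_{\sigma\times\tau}(x)=\langle\theta_\sigma(\triangleright(\pi_1)(x)),\theta_\tau(\triangleright(\pi_2)(x))\rangle$; $\theta_{\sigma\to\tau}(f)(x)=\theta_\tau(f\circledast\mathrm{next}(x))$; $\theta_{\mu\alpha.\tau}(x)=\mathrm{next}(\theta_{\tau[\mu\alpha.\tau/\alpha]})\circledast x$. Put $\delta_\tau=\theta_\tau\circ\mathrm{next}$. A typing judgement $\Gamma\vdash M:\sigma$ is interpreted as a morphism $[\![M]\!]:[\![\Gamma]\!]\to[\![\sigma]\!]$, where $[\![\Gamma]\!]$ is the product of the interpretations of the types in $\Gamma$: variables, $\lambda$, application, pairs and projections by the cartesian closed structure, $[\![\langle\rangle]\!](\gamma)=\eta(*)$, $[\![\mathsf{inl}\,M]\!](\gamma)=\eta(\mathrm{inl}([\![M]\!](\gamma)))$, $[\![\mathsf{inr}\,M]\!](\gamma)=\eta(\mathrm{inr}([\![M]\!](\gamma)))$, $[\![\mathsf{case}\,L\,\mathsf{of}\,x_1.M;x_2.N]\!](\gamma)=\hat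 f([\![L]\!](\gamma))$ with $f(\mathrm{inl}(x_1))=[\![M]\!](\gamma,x_1)$ and $f(\mathrm{inr}(x_2))=[\![N]\!](\gamma,x_2)$, $[\![\mathsf{fold}\,M]\!](\gamma)=\mathrm{next}([\![M]\!](\gamma))$ and $[\![\mathsf{unfold}\,M]\!](\gamma)=\theta_{\tau[\mu\alpha.\tau/\alpha]}([\![M]\!](\gamma))$. **Theorem.** Let $M$ be a closed FPC term with a derivation of $\vdash M:1$, and let $n$ be a natural number. Then $$M\Downarrow^n\langle\rangle\quad\Longleftrightarrow\quad\forall\kappa.\;[\![M]\!](*)=\delta_1^{\,n}(\eta(*)).$$ Here the right-hand side is read in the topos of trees: the set of global elements of the identity type $[\![M]\!](*)=\delta_1^{\,n}(\eta(*))$ is non-empty. -/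

import Mathlib

namespace FPC

/-! ## Syntax of FPC (well-scoped de Bruijn syntax) -/

/-- `Ty k`: the FPC types `Θ ⊢ τ` with `|Θ| = k`; `mu` binds the type variable `0`.
Closed types are the elements of `Ty 0`. -/
inductive Ty : ℕ → Type
  | var {k : ℕ} (i : Fin k) : Ty k
  | one {k : ℕ} : Ty k
  | prod {k : ℕ} (σ τ : Ty k) : Ty k
  | sum {k : ℕ} (σ τ : Ty k) : Ty k
  | arrow {k : ℕ} (σ τ : Ty k) : Ty k
  | mu {k : ℕ} (τ : Ty (k + 1)) : Ty k

/-- Lifting of a renaming under one binder. -/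
def liftRen {k m : ℕ} (r : Fin k → Fin m) : Fin (k + 1) → Fin (m + 1) :=
  Fin.cases 0 (fun i => (r i).succ)

def Ty.rename : {k m : ℕ} → (Fin k → Fin m) → Ty k → Ty m
  | _, _, r, .var i => .var (r i)
  | _, _, _, .one => .one
  | _, _, r, .prod σ τ => .prod (σ.rename r) (τ.rename r)
  | _, _, r, .sum σ τ => .sum (σ.rename r) (τ.rename r)
  | _, _, r, .arrow σ τ => .arrow (σ.rename r) (τ.rename r)
  | _, _, r, .mu τ => .mu (τ.rename (liftRen r))

/-- Lifting of a type substitution under one binder. -/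
def Ty.liftSub {k m : ℕ} (s : Fin k → Ty m) : Fin (k + 1) → Ty (m + 1) :=
  Fin.cases (.var 0) (fun i => (s i).rename Fin.succ)

/-- Simultaneous capture-avoiding substitution of types for type variables. -/
def Ty.subst : {k m : ℕ} → (Fin k → Ty m) → Ty k → Ty m
  | _, _, s, .var i => s i
  | _, _, _, .one => .one
  | _, _, s, .prod σ τ => .prod (σ.subst s) (τ.subst s)
  | _, _, s, .sum σ τ => .sum (σ.subst s) (τ.subst s)
  | _, _, s, .arrow σ τ => .arrow (σ.subst s) (τ.subst s)
  | _, _, s, .mu τ => .mu (τ.subst (Ty.liftSub s))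

/-- `τ[σ/α]`, where `α` is the variable `0`. -/
def Ty.inst {k : ℕ} (τ : Ty (k + 1)) (σ : Ty k) : Ty k :=
  τ.subst (Fin.cases σ Ty.var)

/-- The unfolding `τ[μα.τ/α]` of `μα.τ`. -/
def Ty.unroll {k : ℕ} (τ : Ty (k + 1)) : Ty k := τ.inst (.mu τ)

/-- `Tm n`: raw FPC terms whose free variables are among `n` variables.
`case` binds the variable `0` in each branch, `lam` binds the variable `0` in its body. -/
inductive Tm : ℕ → Type
  | unit {n : ℕ} : Tm n
  | var {n : ℕ} (i : Fin n) : Tm n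
  | inl {n : ℕ} (M : Tm n) : Tm n
  | inr {n : ℕ} (M : Tm n) : Tm n
  | case {n : ℕ} (L : Tm n) (M N : Tm (n + 1)) : Tm n
  | pair {n : ℕ} (M N : Tm n) : Tm n
  | fst {n : ℕ} (M : Tm n) : Tm n
  | snd {n : ℕ} (M : Tm n) : Tm n
  | lam {n : ℕ} (σ : Ty 0) (M : Tm (n + 1)) : Tm n
  | app {n : ℕ} (M N : Tm n) : Tm n
  | fold {n : ℕ} (M : Tm n) : Tm n
  | unfold {n : ℕ} (M : Tm n) : Tm n

def Tm.rename : {n m : ℕ} → (Fin n → Fin m) → Tm n → Tm m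
  | _, _, _, .unit => .unit
  | _, _, r, .var i => .var (r i)
  | _, _, r, .inl M => .inl (M.rename r)
  | _, _, r, .inr M => .inr (M.rename r)
  | _, _, r, .case L M N =>
      .case (L.rename r) (M.rename (liftRen r)) (N.rename (liftRen r))
  | _, _, r, .pair M N => .pair (M.rename r) (N.rename r)
  | _, _, r, .fst M => .fst (M.rename r)
  | _, _, r, .snd M => .snd (M.rename r)
  | _, _, r, .lam σ M => .lam σ (M.rename (liftRen r))
  | _, _, r, .app M N => .app (M.rename r) (N.rename r)
  | _, _, r, .fold M => .fold (M.rename r)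
  | _, _, r, .unfold M => .unfold (M.rename r)

/-- Lifting of a term substitution under one binder. -/
def Tm.liftSub {n m : ℕ} (s : Fin n → Tm m) : Fin (n + 1) → Tm (m + 1) :=
  Fin.cases (.var 0) (fun i => (s i).rename Fin.succ)

/-- Simultaneous capture-avoiding substitution of terms for term variables. -/
def Tm.subst : {n m : ℕ} → (Fin n → Tm m) → Tm n → Tm m
  | _, _, _, .unit => .unit
  | _, _, s, .var i => s i
  | _, _, s, .inl M => .inl (M.subst s)
  | _, _, s, .inr M => .inr (M.subst s)
  | _, _, s, .case L M N =>
      .case (L.subst s) (M.subst (Tm.liftSub s)) (N.subst (Tm.liftSub s))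
  | _, _, s, .pair M N => .pair (M.subst s) (N.subst s)
  | _, _, s, .fst M => .fst (M.subst s)
  | _, _, s, .snd M => .snd (M.subst s)
  | _, _, s, .lam σ M => .lam σ (M.subst (Tm.liftSub s))
  | _, _, s, .app M N => .app (M.subst s) (N.subst s)
  | _, _, s, .fold M => .fold (M.subst s)
  | _, _, s, .unfold M => .unfold (M.subst s)

/-- `M[N/x]`, where `x` is the variable `0`. -/
def Tm.inst {n : ℕ} (M : Tm (n + 1)) (N : Tm n) : Tm n :=
  M.subst (Fin.cases N Tm.var)

/-- Term contexts: the variable `i` has the closed type `Γ i`. -/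
abbrev Ctx (n : ℕ) : Type := Fin n → Ty 0

/-- The context `Γ, x : σ`; the new variable is the variable `0`. -/
def Ctx.cons {n : ℕ} (σ : Ty 0) (Γ : Ctx n) : Ctx (n + 1) := Fin.cases σ Γ

/-- The empty context. -/
def Ctx.nil : Ctx 0 := Fin.elim0

/-- Typing derivations `Γ ⊢ M : σ`. -/
inductive Typing : {n : ℕ} → Ctx n → Tm n → Ty 0 → Type
  | var {n : ℕ} {Γ : Ctx n} (i : Fin n) : Typing Γ (.var i) (Γ i)
  | unit {n : ℕ} {Γ : Ctx n} : Typing Γ .unit .one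
  | lam {n : ℕ} {Γ : Ctx n} {σ τ : Ty 0} {M : Tm (n + 1)} :
      Typing (Γ.cons σ) M τ → Typing Γ (.lam σ M) (.arrow σ τ)
  | app {n : ℕ} {Γ : Ctx n} {σ τ : Ty 0} {M N : Tm n} :
      Typing Γ M (.arrow σ τ) → Typing Γ N σ → Typing Γ (.app M N) τ
  | inl {n : ℕ} {Γ : Ctx n} {τ₁ τ₂ : Ty 0} {M : Tm n} :
      Typing Γ M τ₁ → Typing Γ (.inl M) (.sum τ₁ τ₂)
  | inr {n : ℕ} {Γ : Ctx n} {τ₁ τ₂ : Ty 0} {M : Tm n} :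
      Typing Γ M τ₂ → Typing Γ (.inr M) (.sum τ₁ τ₂)
  | case {n : ℕ} {Γ : Ctx n} {τ₁ τ₂ σ : Ty 0} {L : Tm n} {M N : Tm (n + 1)} :
      Typing Γ L (.sum τ₁ τ₂) → Typing (Γ.cons τ₁) M σ → Typing (Γ.cons τ₂) N σ →
      Typing Γ (.case L M N) σ
  | fst {n : ℕ} {Γ : Ctx n} {τ₁ τ₂ : Ty 0} {M : Tm n} :
      Typing Γ M (.prod τ₁ τ₂) → Typing Γ (.fst M) τ₁
  | snd {n : ℕ} {Γ : Ctx n} {τ₁ τ₂ : Ty 0} {M : Tm n} :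
      Typing Γ M (.prod τ₁ τ₂) → Typing Γ (.snd M) τ₂
  | pair {n : ℕ} {Γ : Ctx n} {τ₁ τ₂ : Ty 0} {M N : Tm n} :
      Typing Γ M τ₁ → Typing Γ N τ₂ → Typing Γ (.pair M N) (.prod τ₁ τ₂)
  | unfold {n : ℕ} {Γ : Ctx n} {τ : Ty 1} {M : Tm n} :
      Typing Γ M (.mu τ) → Typing Γ (.unfold M) τ.unroll
  | fold {n : ℕ} {Γ : Ctx n} {τ : Ty 1} {M : Tm n} :
      Typing Γ M τ.unroll → Typing Γ (.fold M) (.mu τ)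

/-! ## Step-counting call-by-name big-step semantics -/

/-- Values: closed terms whose outermost constructor is an introduction form. -/
inductive IsValue : Tm 0 → Prop
  | unit : IsValue .unit
  | inl (M : Tm 0) : IsValue (.inl M)
  | inr (M : Tm 0) : IsValue (.inr M)
  | pair (M N : Tm 0) : IsValue (.pair M N)
  | lam (σ : Ty 0) (M : Tm 1) : IsValue (.lam σ M)
  | fold (M : Tm 0) : IsValue (.fold M)

/-- `BigStep M k v` is `M ⇓ᵏ v`; the number `k` counts the unfold-fold reductions. -/
inductive BigStep : Tm 0 → ℕ → Tm 0 → Prop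
  | value {v : Tm 0} : IsValue v → BigStep v 0 v
  | caseInl {L L' : Tm 0} {M N : Tm 1} {k m : ℕ} {v : Tm 0} :
      BigStep L k (.inl L') → BigStep (M.inst L') m v → BigStep (.case L M N) (m + k) v
  | caseInr {L L' : Tm 0} {M N : Tm 1} {k m : ℕ} {v : Tm 0} :
      BigStep L k (.inr L') → BigStep (N.inst L') m v → BigStep (.case L M N) (m + k) v
  | fst {L M N : Tm 0} {k l : ℕ} {v : Tm 0} :
      BigStep L k (.pair M N) → BigStep M l v → BigStep (.fst L) (k + l) v
  | snd {L M N : Tm 0} {k l : ℕ} {v : Tm 0} :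
      BigStep L k (.pair M N) → BigStep N l v → BigStep (.snd L) (k + l) v
  | app {M N : Tm 0} {σ : Ty 0} {L : Tm 1} {k l : ℕ} {v : Tm 0} :
      BigStep M k (.lam σ L) → BigStep (L.inst N) l v → BigStep (.app M N) (k + l) v
  | unfold {M N : Tm 0} {k m : ℕ} {v : Tm 0} :
      BigStep M k (.fold N) → BigStep N m v → BigStep (.unfold M) (k + m + 1) v

/-! ## The topos of trees -/

/-- Objects of the topos of trees: presheaves of (small) sets over `ω`. The stages are numbered
from `0`. -/
structure TT : Type 1 where
  obj : ℕ → Type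
  res : ∀ n, obj (n + 1) → obj n

/-- Morphisms of the topos of trees. -/
structure Hom (X Y : TT) : Type where
  app : ∀ n, X.obj n → Y.obj n
  nat : ∀ n (x : X.obj (n + 1)), Y.res n (app (n + 1) x) = app n (X.res n x)

/-- Stage `n` of the universe of small types: presheaves of small sets over `{0, …, n}`. -/
structure Trunc (n : ℕ) : Type 1 where
  obj : ∀ k, k ≤ n → Type
  res : ∀ k (h : k + 1 ≤ n), obj (k + 1) h → obj k (Nat.le_of_succ_le h)

/-- The restriction of an object of the topos of trees to the stages `0, …, n`. -/
def TT.trunc (X : TT) (n : ℕ) : Trunc n where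
  obj k _ := X.obj k
  res k _ := X.res k

/-- The restriction maps of the universe. -/
def Trunc.restrict {n : ℕ} (A : Trunc n) (m : ℕ) (h : m ≤ n) : Trunc m where
  obj k hk := A.obj k (hk.trans h)
  res k hk := A.res k (hk.trans h)

/-- The restriction map from stage `n` to stage `k ≤ n`. -/
def TT.resTo (X : TT) {k n : ℕ} (h : k ≤ n) (x : X.obj n) : X.obj k :=
  Nat.decreasingInduction (motive := fun j _ => X.obj j) (fun j _ y => X.res j y) x h

theorem TT.resTo_self (X : TT) {n : ℕ} (x : X.obj n) : X.resTo le_rfl x = x :=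
  Nat.decreasingInduction_self _ _

theorem TT.res_resTo (X : TT) {k n : ℕ} (h : k + 1 ≤ n) (x : X.obj n) :
    X.res k (X.resTo h x) = X.resTo (Nat.le_of_succ_le h) x :=
  (Nat.decreasingInduction_succ_left (motive := fun j _ => X.obj j)
    (fun j _ y => X.res j y) x h (Nat.le_of_succ_le h)).symm

theorem TT.resTo_res (X : TT) {k n : ℕ} (h : k ≤ n) (x : X.obj (n + 1)) :
    X.resTo h (X.res n x) = X.resTo (h.trans (Nat.le_succ n)) x :=
  (Nat.decreasingInduction_succ (motive := fun j _ => X.obj j)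
    (fun j _ y => X.res j y) x h (h.trans (Nat.le_succ n))).symm

namespace Hom

def id (X : TT) : Hom X X := ⟨fun _ x => x, fun _ _ => rfl⟩

/-- Composition, in diagrammatic order. -/
def comp {X Y Z : TT} (f : Hom X Y) (g : Hom Y Z) : Hom X Z :=
  ⟨fun n x => g.app n (f.app n x), fun n x => by rw [g.nat, f.nat]⟩

/-- The identity morphism between two equal objects. -/
def ofEq {X Y : TT} (h : X = Y) : Hom X Y := h ▸ Hom.id X

end Hom

namespace TT

/-- The terminal object `1`. -/
def one : TT := ⟨fun _ => Unit, fun _ _ => ()⟩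

/-- Binary products. -/
def prod (X Y : TT) : TT :=
  ⟨fun n => X.obj n × Y.obj n, fun n p => (X.res n p.1, Y.res n p.2)⟩

/-- Binary sums. -/
def sum (X Y : TT) : TT :=
  ⟨fun n => X.obj n ⊕ Y.obj n, fun n => Sum.map (X.res n) (Y.res n)⟩

/-- Products of families indexed by a (constant) set. -/
def pi {I : Type} (X : I → TT) : TT :=
  ⟨fun n => ∀ i, (X i).obj n, fun n x i => (X i).res n (x i)⟩

/-- Stage `n` of the exponential: natural families of maps on the stages `0, …, n`. -/
def ExpObj {n : ℕ} (A B : Trunc n) : Type :=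
  {f : ∀ k (h : k ≤ n), A.obj k h → B.obj k h //
    ∀ k (h : k + 1 ≤ n) (x : A.obj (k + 1) h),
      B.res k h (f (k + 1) h x) = f k (Nat.le_of_succ_le h) (A.res k h x)}

/-- Function types. -/
def exp (X Y : TT) : TT where
  obj n := ExpObj (X.trunc n) (Y.trunc n)
  res n f := ⟨fun k h => f.1 k (h.trans (Nat.le_succ n)),
    fun k h => f.2 k (h.trans (Nat.le_succ n))⟩

/-- The functor `▷`: `(▷X)(0) = 1` and `(▷X)(n+1) = X(n)`. -/
def later (X : TT) : TT where
  obj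
    | 0 => Unit
    | n + 1 => X.obj n
  res
    | 0 => fun _ => ()
    | n + 1 => X.res n

/-- Stage `n` of the guarded recursive type `L A = A + ▷ (L A)`. -/
def LiftObj : (n : ℕ) → Trunc n → Type
  | 0, A => A.obj 0 le_rfl ⊕ Unit
  | n + 1, A => A.obj (n + 1) le_rfl ⊕ LiftObj n (A.restrict n (Nat.le_succ n))

def liftRes : (n : ℕ) → (A : Trunc (n + 1)) →
    LiftObj (n + 1) A → LiftObj n (A.restrict n (Nat.le_succ n))
  | 0, A => Sum.map (A.res 0 le_rfl) (fun _ => ())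
  | n + 1, A => Sum.map (A.res (n + 1) le_rfl)
      (liftRes n (A.restrict (n + 1) (Nat.le_succ (n + 1))))

/-- The lifting monad `L`, the solution of `L A = A + ▷ (L A)`. -/
def lift (X : TT) : TT where
  obj n := LiftObj n (X.trunc n)
  res n := liftRes n (X.trunc (n + 1))

end TT

namespace Hom

def fst (X Y : TT) : Hom (X.prod Y) X := ⟨fun _ p => p.1, fun _ _ => rfl⟩

def snd (X Y : TT) : Hom (X.prod Y) Y := ⟨fun _ p => p.2, fun _ _ => rfl⟩

def pair {Z X Y : TT} (f : Hom Z X) (g : Hom Z Y) : Hom Z (X.prod Y) :=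
  ⟨fun n z => (f.app n z, g.app n z), fun n z => Prod.ext (f.nat n z) (g.nat n z)⟩

def inl (X Y : TT) : Hom X (X.sum Y) := ⟨fun _ x => Sum.inl x, fun _ _ => rfl⟩

def inr (X Y : TT) : Hom Y (X.sum Y) := ⟨fun _ y => Sum.inr y, fun _ _ => rfl⟩

/-- Definition by cases on a sum, in a context `Γ`. -/
def cases {Γ X Y Z : TT} (f : Hom (Γ.prod X) Z) (g : Hom (Γ.prod Y) Z) :
    Hom (Γ.prod (X.sum Y)) Z where
  app n p := match p.2 with
    | Sum.inl x => f.app n (p.1, x)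
    | Sum.inr y => g.app n (p.1, y)
  nat n := by
    rintro ⟨γ, x | y⟩
    · exact f.nat n (γ, x)
    · exact g.nat n (γ, y)

def proj {I : Type} (X : I → TT) (i : I) : Hom (TT.pi X) (X i) :=
  ⟨fun _ x => x i, fun _ _ => rfl⟩

def tuple {Z : TT} {I : Type} {X : I → TT} (f : ∀ i, Hom Z (X i)) : Hom Z (TT.pi X) :=
  ⟨fun n z i => (f i).app n z, fun n z => funext fun i => (f i).nat n z⟩

/-- Evaluation. -/
def ev (X Y : TT) : Hom ((X.exp Y).prod X) Y :=
  ⟨fun n p => p.1.1 n le_rfl p.2, fun n p => p.1.2 n le_rfl p.2⟩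

/-- Lambda abstraction. -/
def curry {Γ X Y : TT} (f : Hom (Γ.prod X) Y) : Hom Γ (X.exp Y) where
  app n γ := ⟨fun k h x => f.app k (Γ.resTo h γ, x), fun k h x => by
    refine (f.nat k (Γ.resTo h γ, x)).trans ?_
    change f.app k (Γ.res k (Γ.resTo h γ), _) = _
    rw [Γ.res_resTo]
    rfl⟩
  nat n γ := by
    apply Subtype.ext
    funext k h x
    change f.app k (Γ.resTo _ γ, x) = f.app k (Γ.resTo h (Γ.res n γ), x)
    rw [Γ.resTo_res]

/-- The introduction form `next : X → ▷X`. -/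
def next (X : TT) : Hom X X.later where
  app
    | 0 => fun _ => ()
    | n + 1 => X.res n
  nat
    | 0 => fun _ => rfl
    | _ + 1 => fun _ => rfl

/-- The functorial action of `▷`. -/
def laterMap {X Y : TT} (f : Hom X Y) : Hom X.later Y.later where
  app
    | 0 => fun _ => ()
    | n + 1 => f.app n
  nat
    | 0 => fun _ => rfl
    | n + 1 => f.nat n

/-- Later application `⊛ : ▷(X → Y) × ▷X → ▷Y`. -/
def laterApp (X Y : TT) : Hom ((X.exp Y).later.prod X.later) Y.later where
  app
    | 0 => fun _ => ()
    | n + 1 => (ev X Y).app n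
  nat
    | 0 => fun _ => rfl
    | n + 1 => (ev X Y).nat n

/-- The unit `η : X → L X`. -/
def now (X : TT) : Hom X X.lift where
  app
    | 0 => fun x => Sum.inl x
    | _ + 1 => fun x => Sum.inl x
  nat
    | 0 => fun _ => rfl
    | _ + 1 => fun _ => rfl

/-- The map `θ : ▷ (L X) → L X`. -/
def tickLift (X : TT) : Hom X.lift.later X.lift where
  app
    | 0 => fun x => Sum.inr x
    | _ + 1 => fun x => Sum.inr x
  nat
    | 0 => fun _ => rfl
    | _ + 1 => fun _ => rfl

/-- The underlying maps of the extension `f̂` below. -/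
def hatApp {Γ X Y : TT} (θ : Hom Y.later Y) (f : Hom (Γ.prod X) Y) :
    (n : ℕ) → Γ.obj n → X.lift.obj n → Y.obj n
  | 0, γ, Sum.inl x => f.app 0 (γ, x)
  | 0, _, Sum.inr _ => θ.app 0 ()
  | n + 1, γ, Sum.inl x => f.app (n + 1) (γ, x)
  | n + 1, γ, Sum.inr r => θ.app (n + 1) (hatApp θ f n (Γ.res n γ) r)

theorem hatApp_nat {Γ X Y : TT} (θ : Hom Y.later Y) (f : Hom (Γ.prod X) Y) :
    ∀ (n : ℕ) (γ : Γ.obj (n + 1)) (x : X.lift.obj (n + 1)),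
      Y.res n (hatApp θ f (n + 1) γ x) = hatApp θ f n (Γ.res n γ) (X.lift.res n x)
  | 0, γ, Sum.inl x => f.nat 0 (γ, x)
  | 0, _, Sum.inr _ => θ.nat 0 _
  | n + 1, γ, Sum.inl x => f.nat (n + 1) (γ, x)
  | n + 1, γ, Sum.inr r =>
      (θ.nat (n + 1) _).trans
        (congrArg (θ.app (n + 1)) (hatApp_nat θ f n (Γ.res (n + 1) γ) r))

/-- The extension `f̂ : L X → Y` of a map `f : X → Y` into a `▷`-algebra `(Y, θ)`, in a context
`Γ`: the guarded recursive map with `f̂ (η x) = f x` and `f̂ (θ r) = θ (next f̂ ⊛ r)`. -/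
def hat {Γ X Y : TT} (θ : Hom Y.later Y) (f : Hom (Γ.prod X) Y) : Hom (Γ.prod X.lift) Y :=
  ⟨fun n p => hatApp θ f n p.1 p.2, fun n p => hatApp_nat θ f n p.1 p.2⟩

end Hom

/-! ## Universal quantification over the clock -/

/-- `∀κ. X`: the set of global elements of `X`. -/
structure ForallClock (X : TT) : Type where
  val : ∀ n, X.obj n
  compat : ∀ n, X.res n (val (n + 1)) = val n

/-- The identity type `x = y` of two terms `x, y : X` that depend on the clock only. -/
def TT.eq {X : TT} (x y : ForallClock X) : TT where
  obj n := PLift (x.val n = y.val n)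
  res n p := ⟨by rw [← x.compat, ← y.compat, p.down]⟩

/-- Application of a map to a term that depends on the clock only. -/
def Hom.apply {X Y : TT} (f : Hom X Y) (x : ForallClock X) : ForallClock Y :=
  ⟨fun n => f.app n (x.val n), fun n => by rw [f.nat, x.compat]⟩

/-- The unique element `*` of `1`. -/
def TT.star : ForallClock TT.one := ⟨fun _ => (), fun _ => rfl⟩

/-- The underlying family of the guarded fixed point below. -/
def gfixVal {X : TT} (g : Hom X.later X) : ∀ n, X.obj n
  | 0 => g.app 0 ()
  | n + 1 => g.app (n + 1) (gfixVal g n)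

/-- The guarded fixed point of `g : ▷X → X`, with `gfix g = g (next (gfix g))`. -/
def gfix {X : TT} (g : Hom X.later X) : ForallClock X where
  val := gfixVal g
  compat n := by
    induction n with
    | zero => exact g.nat 0 _
    | succ n ih => exact (g.nat (n + 1) _).trans (congrArg (g.app (n + 1)) ih)

/-- The morphism given by a global element of a function type. -/
def ForallClock.toHom {X Y : TT} (f : ForallClock (X.exp Y)) : Hom X Y where
  app n x := (f.val n).1 n le_rfl x
  nat n x := by
    refine ((f.val (n + 1)).2 n le_rfl x).trans ?_
    rw [← f.compat n]
    rfl

/-! ## Guarded recursive types -/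

theorem Trunc.ext_heq {n : ℕ} {P Q : Trunc n} (hobj : P.obj = Q.obj)
    (hres : ∀ k h, HEq (P.res k h) (Q.res k h)) : P = Q := by
  obtain ⟨Po, Pr⟩ := P
  obtain ⟨Qo, Qr⟩ := Q
  obtain rfl : Po = Qo := hobj
  obtain rfl : Pr = Qr := funext fun k => funext fun h => eq_of_heq (hres k h)
  rfl

theorem TT.ext_trunc {X Y : TT} (h : ∀ n, X.trunc n = Y.trunc n) : X = Y := by
  have ho : X.obj = Y.obj := funext fun n =>
    congrFun (congrFun (eq_of_heq (Trunc.mk.injEq .. ▸ h n).1.heq) n) le_rfl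
  obtain ⟨Xo, Xr⟩ := X
  obtain ⟨Yo, Yr⟩ := Y
  obtain rfl : Xo = Yo := ho
  have hr : Xr = Yr := by
    funext n
    have := h (n + 1)
    simp only [TT.trunc, Trunc.mk.injEq, heq_eq_eq, true_and] at this
    exact congrFun (congrFun this n) le_rfl
  rw [hr]

theorem TT.trunc_mono {X Y : TT} {m n : ℕ} (h : m ≤ n) (e : X.trunc n = Y.trunc n) :
    X.trunc m = Y.trunc m :=
  congrArg (fun A : Trunc n => A.restrict m h) e

/-- Maps on objects that are contractive: stage `n` of the result depends only on the earlier
stages of the argument. These are the maps that factor through `▷`. -/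
def Contractive (F : TT → TT) : Prop :=
  ∀ n X Y, (∀ m, m < n → X.trunc m = Y.trunc m) → (F X).trunc n = (F Y).trunc n

/-- Iterates of `F` on the terminal object. -/
def approx (F : TT → TT) : ℕ → TT
  | 0 => TT.one
  | n + 1 => F (approx F n)

theorem approx_trunc {F : TT → TT} (hF : Contractive F) :
    ∀ n i j, n < i → n < j → (approx F i).trunc n = (approx F j).trunc n := by
  intro n
  induction n using Nat.strong_induction_on with
  | _ n ih =>
    rintro (_ | i) (_ | j) hi hj
    · omega
    · omega
    · omega
    · exact hF n _ _ fun m hm => ih m hm i j (by omega) (by omega)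

theorem approx_obj {F : TT → TT} (hF : Contractive F) {n i j : ℕ} (hi : n < i) (hj : n < j) :
    (approx F i).obj n = (approx F j).obj n :=
  congrArg (fun A : Trunc n => A.obj n le_rfl) (approx_trunc hF n i j hi hj)

/-- The guarded recursive type defined by a contractive `F`: the unique `X` with `X = F X`.
Its stage `n` is stage `n` of the `(n+1)`-st iterate of `F`. -/
def fixTT (F : TT → TT) (hF : Contractive F) : TT where
  obj n := (approx F (n + 1)).obj n
  res n x := cast (approx_obj hF (by omega) (by omega)) ((approx F (n + 2)).res n x)

theorem fixTT_trunc {F : TT → TT} (hF : Contractive F) (n i : ℕ) (hi : n < i) :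
    (fixTT F hF).trunc n = (approx F i).trunc n := by
  have hfun : ∀ {A A' B B' : Type} (f : A → B) (f' : A' → B') (hA : A = A') (hB : B = B'),
      (∀ x, f' (cast hA x) = cast hB (f x)) → HEq f f' := by
    intro A A' B B' f f' hA hB h
    subst hA
    subst hB
    exact heq_of_eq (funext fun x => (h x).symm)
  have key : ∀ {m : ℕ} (P Q : Trunc m), P = Q → ∀ k (h : k + 1 ≤ m), HEq (P.res k h) (Q.res k h) := by
    intro m P Q e k h
    rw [e]
  have hobj : ((fixTT F hF).trunc n).obj = ((approx F i).trunc n).obj := by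
    funext k hk
    exact approx_obj hF (by omega) (by omega)
  refine Trunc.ext_heq hobj fun k h => ?_
  refine HEq.trans (b := (approx F (k + 2)).res k) ?_ ?_
  · exact hfun _ _ rfl (approx_obj hF (by omega) (by omega)) fun x => by simp [TT.trunc, fixTT]; rfl
  · exact key ((approx F (k + 2)).trunc (k + 1)) ((approx F i).trunc (k + 1))
      (approx_trunc hF _ _ _ (by omega) (by omega)) k le_rfl

theorem fixTT_congr {F G : TT → TT} (hF : Contractive F) (hG : Contractive G) (h : F = G) :
    fixTT F hF = fixTT G hG := by
  subst h
  rfl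

theorem fixTT_eq {F : TT → TT} (hF : Contractive F) : fixTT F hF = F (fixTT F hF) := by
  apply TT.ext_trunc
  intro n
  rw [fixTT_trunc hF n (n + 1) (by omega)]
  exact hF n _ _ fun m hm => (fixTT_trunc hF m n hm).symm

/-- `▷` on the stages `0, …, n + 1`. -/
def Trunc.later {n : ℕ} (A : Trunc n) : Trunc (n + 1) where
  obj
    | 0, _ => Unit
    | k + 1, h => A.obj k (Nat.le_of_succ_le_succ h)
  res
    | 0, _ => fun _ => ()
    | k + 1, h => A.res k (Nat.le_of_succ_le_succ h)

theorem TT.later_trunc_succ (X : TT) (n : ℕ) : X.later.trunc (n + 1) = (X.trunc n).later := by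
  have hobj : (X.later.trunc (n + 1)).obj = ((X.trunc n).later).obj := by
    funext k hk
    cases k <;> rfl
  refine Trunc.ext_heq hobj fun k h => ?_
  cases k <;> rfl

theorem later_trunc {X Y : TT} {n : ℕ} (h : ∀ m, m < n → X.trunc m = Y.trunc m) :
    X.later.trunc n = Y.later.trunc n := by
  cases n with
  | zero =>
    have : ∀ Z : TT, Z.later.trunc 0 = ⟨fun _ _ => Unit, fun _ _ _ => ()⟩ := by
      intro Z
      have hobj : (Z.later.trunc 0).obj = fun _ _ => Unit := by
        funext k hk
        obtain rfl : k = 0 := by omega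
        rfl
      exact Trunc.ext_heq hobj fun k h => absurd h (by omega)
    rw [this X, this Y]
  | succ n => rw [TT.later_trunc_succ, TT.later_trunc_succ, h n (Nat.lt_succ_self n)]

theorem TT.prod_trunc {X X' Y Y' : TT} {n : ℕ} (hX : X.trunc n = X'.trunc n)
    (hY : Y.trunc n = Y'.trunc n) : (X.prod Y).trunc n = (X'.prod Y').trunc n :=
  congrArg₂ (fun A B : Trunc n => (⟨fun k h => A.obj k h × B.obj k h,
    fun k h p => (A.res k h p.1, B.res k h p.2)⟩ : Trunc n)) hX hY

theorem TT.sum_trunc {X X' Y Y' : TT} {n : ℕ} (hX : X.trunc n = X'.trunc n)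
    (hY : Y.trunc n = Y'.trunc n) : (X.sum Y).trunc n = (X'.sum Y').trunc n :=
  congrArg₂ (fun A B : Trunc n => (⟨fun k h => A.obj k h ⊕ B.obj k h,
    fun k h => Sum.map (A.res k h) (B.res k h)⟩ : Trunc n)) hX hY

theorem TT.exp_trunc {X X' Y Y' : TT} {n : ℕ} (hX : X.trunc n = X'.trunc n)
    (hY : Y.trunc n = Y'.trunc n) : (X.exp Y).trunc n = (X'.exp Y').trunc n :=
  congrArg₂ (fun A B : Trunc n => (⟨fun k h => ExpObj (A.restrict k h) (B.restrict k h),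
    fun k _ f => ⟨fun j hj => f.1 j (hj.trans (Nat.le_succ k)),
      fun j hj => f.2 j (hj.trans (Nat.le_succ k))⟩⟩ : Trunc n)) hX hY

theorem TT.lift_trunc {X X' : TT} {n : ℕ} (hX : X.trunc n = X'.trunc n) :
    X.lift.trunc n = X'.lift.trunc n :=
  congrArg (fun A : Trunc n => (⟨fun k h => LiftObj k (A.restrict k h),
    fun k h => liftRes k (A.restrict (k + 1) h)⟩ : Trunc n)) hX

/-- Maps `Uᵏ → U` on the universe of small types, given by their action on global elements
(objects of the topos of trees). By `trunc_eq`, stage `n` of the result depends on the stages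
`0, …, n` of the arguments only. -/
structure UMap (k : ℕ) : Type 1 where
  toFun : (Fin k → TT) → TT
  trunc_eq : ∀ n ρ ρ', (∀ i, (ρ i).trunc n = (ρ' i).trunc n) →
    (toFun ρ).trunc n = (toFun ρ').trunc n

/-- The environment `(ρ, Y)`; the new variable is the variable `0`. -/
def envCons {k : ℕ} (Y : TT) (ρ : Fin k → TT) : Fin (k + 1) → TT := Fin.cases Y ρ

theorem UMap.contractive {k : ℕ} (F : UMap (k + 1)) (ρ : Fin k → TT) :
    Contractive fun Y => (F.toFun (envCons Y ρ)).later := by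
  intro n X Y h
  refine later_trunc fun m hm => F.trunc_eq m _ _ ?_
  intro i
  refine Fin.cases (h m hm) (fun _ => rfl) i

/-- The guarded recursive type `X = ▷ F(ρ, X)`, as a map of `ρ`. -/
def UMap.mu {k : ℕ} (F : UMap (k + 1)) : UMap k where
  toFun ρ := fixTT _ (F.contractive ρ)
  trunc_eq n := by
    induction n using Nat.strong_induction_on with
    | _ n ih =>
      intro ρ ρ' h
      rw [fixTT_eq (F.contractive ρ), fixTT_eq (F.contractive ρ')]
      refine later_trunc fun m hm => F.trunc_eq m _ _ ?_
      intro i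
      refine Fin.cases ?_ (fun j => TT.trunc_mono hm.le (h j)) i
      exact ih m hm ρ ρ' fun j => TT.trunc_mono hm.le (h j)

/-! ## Denotational semantics of types -/

/-- The interpretation `⟦Θ ⊢ τ⟧ : U^|Θ| → U`. -/
def interp : {k : ℕ} → Ty k → UMap k
  | _, .var i => ⟨fun ρ => ρ i, fun _ _ _ h => h i⟩
  | _, .one => ⟨fun _ => TT.one.lift, fun _ _ _ _ => rfl⟩
  | _, .prod σ τ => ⟨fun ρ => ((interp σ).toFun ρ).prod ((interp τ).toFun ρ), fun n ρ ρ' h =>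
      TT.prod_trunc ((interp σ).trunc_eq n ρ ρ' h) ((interp τ).trunc_eq n ρ ρ' h)⟩
  | _, .sum σ τ => ⟨fun ρ => (((interp σ).toFun ρ).sum ((interp τ).toFun ρ)).lift, fun n ρ ρ' h =>
      TT.lift_trunc (TT.sum_trunc ((interp σ).trunc_eq n ρ ρ' h) ((interp τ).trunc_eq n ρ ρ' h))⟩
  | _, .arrow σ τ => ⟨fun ρ => ((interp σ).toFun ρ).exp ((interp τ).toFun ρ), fun n ρ ρ' h =>
      TT.exp_trunc ((interp σ).trunc_eq n ρ ρ' h) ((interp τ).trunc_eq n ρ ρ' h)⟩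
  | _, .mu τ => (interp τ).mu

/-- The interpretation `⟦τ⟧` of a closed type. -/
def Ty.den (τ : Ty 0) : TT := (interp τ).toFun Fin.elim0

theorem interp_rename {k : ℕ} (τ : Ty k) : ∀ {m : ℕ} (r : Fin k → Fin m) (ρ : Fin m → TT),
    (interp (τ.rename r)).toFun ρ = (interp τ).toFun fun i => ρ (r i) := by
  induction τ with
  | var i => exact fun _ _ => rfl
  | one => exact fun _ _ => rfl
  | prod σ τ ihσ ihτ => exact fun r ρ => congrArg₂ TT.prod (ihσ r ρ) (ihτ r ρ)
  | sum σ τ ihσ ihτ =>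
    exact fun r ρ => congrArg TT.lift (congrArg₂ TT.sum (ihσ r ρ) (ihτ r ρ))
  | arrow σ τ ihσ ihτ => exact fun r ρ => congrArg₂ TT.exp (ihσ r ρ) (ihτ r ρ)
  | mu τ ih =>
    intro m r ρ
    refine fixTT_congr (UMap.contractive _ _) (UMap.contractive _ _) (funext fun Y => ?_)
    refine congrArg TT.later ((ih (liftRen r) (envCons Y ρ)).trans ?_)
    refine congrArg (interp τ).toFun (funext fun i => ?_)
    refine Fin.cases rfl (fun _ => rfl) i

/-- Substitution lemma for types. -/
theorem interp_subst {k : ℕ} (τ : Ty k) : ∀ {m : ℕ} (s : Fin k → Ty m) (ρ : Fin m → TT),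
    (interp (τ.subst s)).toFun ρ = (interp τ).toFun fun i => (interp (s i)).toFun ρ := by
  induction τ with
  | var i => exact fun _ _ => rfl
  | one => exact fun _ _ => rfl
  | prod σ τ ihσ ihτ => exact fun s ρ => congrArg₂ TT.prod (ihσ s ρ) (ihτ s ρ)
  | sum σ τ ihσ ihτ =>
    exact fun s ρ => congrArg TT.lift (congrArg₂ TT.sum (ihσ s ρ) (ihτ s ρ))
  | arrow σ τ ihσ ihτ => exact fun s ρ => congrArg₂ TT.exp (ihσ s ρ) (ihτ s ρ)
  | mu τ ih =>
    intro m s ρ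
    refine fixTT_congr (UMap.contractive _ _) (UMap.contractive _ _) (funext fun Y => ?_)
    refine congrArg TT.later ((ih (Ty.liftSub s) (envCons Y ρ)).trans ?_)
    refine congrArg (interp τ).toFun (funext fun i => ?_)
    refine Fin.cases rfl (fun j => ?_) i
    exact interp_rename (s j) Fin.succ (envCons Y ρ)

/-- `⟦μα.τ⟧ = ▷⟦τ[μα.τ/α]⟧`. -/
theorem den_mu (τ : Ty 1) : (Ty.mu τ).den = τ.unroll.den.later := by
  refine (fixTT_eq ((interp τ).contractive Fin.elim0)).trans (congrArg TT.later ?_)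
  refine Eq.trans ?_ (interp_subst τ _ Fin.elim0).symm
  refine congrArg (interp τ).toFun (funext fun i => ?_)
  exact Fin.cases rfl (fun j => j.elim0) i

/-! ## The `▷`-algebra structure on the interpretation of closed types -/

/-- `Π σ : Ty 0. (▷⟦σ⟧ → ⟦σ⟧)`. -/
def TickFam : TT := TT.pi fun σ : Ty 0 => σ.den.later.exp σ.den

/-- The component at `τ` of the map `G : ▷(Π σ. (▷⟦σ⟧ → ⟦σ⟧)) → Π σ. (▷⟦σ⟧ → ⟦σ⟧)`, defined by
structural induction on the closed type `τ`; written as a map of the two variables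
`F : ▷(Π σ. (▷⟦σ⟧ → ⟦σ⟧))` and `x : ▷⟦τ⟧`. -/
def tickStep : {k : ℕ} → (τ : Ty k) → (h : k = 0) →
    Hom (TickFam.later.prod (Ty.den (h ▸ τ)).later) (Ty.den (h ▸ τ))
  | 0, .one, rfl => (Hom.snd _ _).comp (Hom.tickLift TT.one)
  | 0, .prod σ τ, rfl =>
      let F := Hom.fst TickFam.later (σ.den.prod τ.den).later
      let x := Hom.snd TickFam.later (σ.den.prod τ.den).later
      Hom.pair
        ((F.pair (x.comp (Hom.laterMap (Hom.fst σ.den τ.den)))).comp (tickStep σ rfl))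
        ((F.pair (x.comp (Hom.laterMap (Hom.snd σ.den τ.den)))).comp (tickStep τ rfl))
  | 0, .sum σ τ, rfl => (Hom.snd _ _).comp (Hom.tickLift (σ.den.sum τ.den))
  | 0, .arrow σ τ, rfl =>
      let Γ := TickFam.later.prod (σ.den.exp τ.den).later
      let F : Hom (Γ.prod σ.den) TickFam.later := (Hom.fst Γ σ.den).comp (Hom.fst _ _)
      let f : Hom (Γ.prod σ.den) (σ.den.exp τ.den).later :=
        (Hom.fst Γ σ.den).comp (Hom.snd _ _)
      let x : Hom (Γ.prod σ.den) σ.den := Hom.snd Γ σ.den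
      Hom.curry
        ((F.pair ((f.pair (x.comp (Hom.next σ.den))).comp (Hom.laterApp σ.den τ.den))).comp
          (tickStep τ rfl))
  | 0, .mu τ, rfl =>
      let F : Hom (TickFam.later.prod (Ty.mu τ).den.later) TickFam.later := Hom.fst _ _
      let x : Hom (TickFam.later.prod (Ty.mu τ).den.later) (Ty.mu τ).den.later := Hom.snd _ _
      ((F.comp (Hom.laterMap (Hom.proj _ τ.unroll))).pair
        (x.comp (Hom.laterMap (Hom.ofEq (den_mu τ))))).comp
        ((Hom.laterApp τ.unroll.den.later τ.unroll.den).comp (Hom.ofEq (den_mu τ).symm))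

/-- The map `θ_τ : ▷⟦τ⟧ → ⟦τ⟧`. -/
def tick (τ : Ty 0) : Hom τ.den.later τ.den :=
  ((Hom.proj _ τ).apply (gfix (X := TickFam)
    (Hom.tuple fun σ : Ty 0 => Hom.curry (tickStep σ rfl)))).toHom

/-- The delay `δ_τ = θ_τ ∘ next : ⟦τ⟧ → ⟦τ⟧`. -/
def delay (τ : Ty 0) : Hom τ.den τ.den := (Hom.next τ.den).comp (tick τ)

/-! ## Denotational semantics of terms -/

/-- The interpretation `⟦Γ⟧` of a context: the product of the interpretations of its types. -/
def Ctx.den {n : ℕ} (Γ : Ctx n) : TT := TT.pi fun i => (Γ i).den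

/-- The unique element `*` of the interpretation of the empty context. -/
def starNil : ForallClock Ctx.nil.den := ⟨fun _ i => i.elim0, fun _ => funext fun i => i.elim0⟩

/-- `(γ, x) : ⟦Γ, x : σ⟧` for `γ : ⟦Γ⟧` and `x : ⟦σ⟧`. -/
def extend {n : ℕ} (Γ : Ctx n) (σ : Ty 0) : Hom (Γ.den.prod σ.den) (Γ.cons σ).den where
  app _ p := Fin.cases p.2 p.1
  nat _ _ := funext fun i => Fin.cases rfl (fun _ => rfl) i

/-- The interpretation `⟦Γ ⊢ M : σ⟧ : ⟦Γ⟧ → ⟦σ⟧`. -/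
def Typing.den : {n : ℕ} → {Γ : Ctx n} → {M : Tm n} → {σ : Ty 0} → Typing Γ M σ →
    Hom Γ.den σ.den
  | _, Γ, _, _, .var i => Hom.proj (fun i => (Γ i).den) i
  | _, _, _, _, .unit => Hom.comp ⟨fun _ _ => (), fun _ _ => rfl⟩ (Hom.now TT.one)
  | _, Γ, _, _, .lam (σ := σ) d => Hom.curry ((extend Γ σ).comp d.den)
  | _, _, _, _, .app (σ := σ) (τ := τ) d e => (Hom.pair d.den e.den).comp (Hom.ev σ.den τ.den)
  | _, _, _, _, .inl (τ₁ := τ₁) (τ₂ := τ₂) d =>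
      d.den.comp ((Hom.inl τ₁.den τ₂.den).comp (Hom.now _))
  | _, _, _, _, .inr (τ₁ := τ₁) (τ₂ := τ₂) d =>
      d.den.comp ((Hom.inr τ₁.den τ₂.den).comp (Hom.now _))
  | _, Γ, _, _, .case (τ₁ := τ₁) (τ₂ := τ₂) (σ := σ) d e₁ e₂ =>
      (Hom.pair (Hom.id Γ.den) d.den).comp
        (Hom.hat (X := τ₁.den.sum τ₂.den) (tick σ)
          (Hom.cases ((extend Γ τ₁).comp e₁.den) ((extend Γ τ₂).comp e₂.den)))
  | _, _, _, _, .fst (τ₁ := τ₁) (τ₂ := τ₂) d => d.den.comp (Hom.fst τ₁.den τ₂.den)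
  | _, _, _, _, .snd (τ₁ := τ₁) (τ₂ := τ₂) d => d.den.comp (Hom.snd τ₁.den τ₂.den)
  | _, _, _, _, .pair d e => Hom.pair d.den e.den
  | _, _, _, _, .unfold (τ := τ) d => d.den.comp ((Hom.ofEq (den_mu τ)).comp (tick τ.unroll))
  | _, _, _, _, .fold (τ := τ) d =>
      d.den.comp ((Hom.next τ.unroll.den).comp (Hom.ofEq (den_mu τ).symm))

end FPC

namespace FPC

/-! ## The equations of `θ` -/

/-- The delayed family of all maps `θ_σ`, at stage `n`. -/
def tickFamLater (n : ℕ) : TickFam.later.obj n :=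
  (Hom.next TickFam).app n ((gfix (X := TickFam)
    (Hom.tuple fun σ : Ty 0 => Hom.curry (tickStep σ rfl))).val n)

theorem tickFamLater_res (n : ℕ) : TickFam.later.res n (tickFamLater (n + 1)) = tickFamLater n := by
  unfold tickFamLater
  rw [Hom.nat, ForallClock.compat]

theorem TT.resTo_global {X : TT} (x : ForallClock X) {k n : ℕ} (h : k ≤ n) :
    X.resTo h (x.val n) = x.val k := by
  induction n, h using Nat.le_induction with
  | base => exact X.resTo_self _
  | succ n h ih => rw [← X.resTo_res h, x.compat, ih]

theorem TT.prod_resTo {X Y : TT} {k n : ℕ} (h : k ≤ n) (p : (X.prod Y).obj n) :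
    (X.prod Y).resTo h p = (X.resTo h p.1, Y.resTo h p.2) := by
  induction n, h using Nat.le_induction with
  | base =>
    exact ((X.prod Y).resTo_self p).trans (Prod.ext (X.resTo_self _).symm (Y.resTo_self _).symm)
  | succ n h ih =>
    rw [← TT.resTo_res _ h, ih, ← X.resTo_res h, ← Y.resTo_res h]
    rfl

theorem TT.exp_resTo {X Y : TT} {k n : ℕ} (h : k ≤ n) (f : (X.exp Y).obj n) (j : ℕ) (hj : j ≤ k)
    (x : X.obj j) : ((X.exp Y).resTo h f).1 j hj x = f.1 j (hj.trans h) x := by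
  induction n, h using Nat.le_induction with
  | base => rw [TT.resTo_self]
  | succ n h ih =>
    rw [← TT.resTo_res _ h, ih]
    rfl

theorem TT.later_resTo_succ {X : TT} {k n : ℕ} (h : k ≤ n) (x : X.obj n) :
    X.later.resTo (Nat.succ_le_succ h) (show X.later.obj (n + 1) from x) = X.resTo h x := by
  induction n, h using Nat.le_induction with
  | base => exact (X.later.resTo_self (n := k + 1) x).trans (X.resTo_self x).symm
  | succ n h ih =>
    rw [← TT.resTo_res _ (Nat.succ_le_succ h), ← X.resTo_res h]
    exact ih _

theorem gfix_val {X : TT} (g : Hom X.later X) (n : ℕ) :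
    (gfix g).val n = g.app n ((Hom.next X).app n ((gfix g).val n)) := by
  cases n with
  | zero => rfl
  | succ n =>
    change _ = g.app (n + 1) (X.res n ((gfix g).val (n + 1)))
    rw [(gfix g).compat]
    rfl

theorem tick_app (τ : Ty 0) (n : ℕ) (x : τ.den.later.obj n) :
    (tick τ).app n x = (tickStep τ rfl).app n (tickFamLater n, x) := by
  refine (congrArg (fun F : TickFam.obj n => (F τ).1 n le_rfl x)
    (gfix_val (X := TickFam) _ n)).trans ?_
  change (tickStep τ rfl).app n (TickFam.later.resTo le_rfl (tickFamLater n), x) = _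
  rw [TT.resTo_self]

theorem tick_one (n : ℕ) (x : (Ty.den .one).later.obj n) :
    (tick .one).app n x = (Hom.tickLift TT.one).app n x := tick_app _ _ _

theorem tick_sum (σ τ : Ty 0) (n : ℕ) (x : (Ty.den (.sum σ τ)).later.obj n) :
    (tick (.sum σ τ)).app n x = (Hom.tickLift (σ.den.sum τ.den)).app n x := tick_app _ _ _

theorem tick_prod (σ τ : Ty 0) (n : ℕ) (x : (Ty.den (.prod σ τ)).later.obj n) :
    (tick (.prod σ τ)).app n x =
      ((tick σ).app n ((Hom.laterMap (Hom.fst σ.den τ.den)).app n x),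
        (tick τ).app n ((Hom.laterMap (Hom.snd σ.den τ.den)).app n x)) := by
  rw [tick_app, tick_app, tick_app]
  rfl

theorem tick_arrow (σ τ : Ty 0) (n : ℕ) (f : (Ty.den (.arrow σ τ)).later.obj n) (k : ℕ)
    (h : k ≤ n) (x : σ.den.obj k) :
    Subtype.val (p := fun _ => _) ((tick (.arrow σ τ)).app n f) k h x =
      (tick τ).app k ((Hom.laterApp σ.den τ.den).app k
        ((σ.den.exp τ.den).later.resTo h f, (Hom.next σ.den).app k x)) := by
  rw [tick_app, tick_app]
  refine (congrArg (fun p : (TickFam.later.prod (σ.den.exp τ.den).later).obj k =>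
    (tickStep τ rfl).app k
      (p.1, (Hom.laterApp σ.den τ.den).app k (p.2, (Hom.next σ.den).app k x)))
    (TT.prod_resTo h (tickFamLater n, f))).trans ?_
  exact congrArg (fun F => (tickStep τ rfl).app k (F, (Hom.laterApp σ.den τ.den).app k _))
    (TT.resTo_global ⟨tickFamLater, tickFamLater_res⟩ h)

theorem Hom.ofEq_symm_app {X Y : TT} (h : X = Y) (n : ℕ) (y : Y.obj n) :
    (Hom.ofEq h).app n ((Hom.ofEq h.symm).app n y) = y := by
  subst h
  rfl

theorem tick_mu (τ : Ty 1) (n : ℕ) (x : (Ty.den (.mu τ)).later.obj (n + 1)) :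
    (Hom.ofEq (den_mu τ)).app (n + 1) ((tick (.mu τ)).app (n + 1) x) =
      (tick τ.unroll).app n ((Hom.ofEq (den_mu τ)).app n x) := by
  rw [tick_app]
  change (Hom.ofEq (den_mu τ)).app (n + 1) ((Hom.ofEq (den_mu τ).symm).app (n + 1) _) = _
  rw [Hom.ofEq_symm_app]
  change ((TickFam.res n ((gfix (X := TickFam) (Hom.tuple fun σ : Ty 0 =>
    Hom.curry (tickStep σ rfl))).val (n + 1))) τ.unroll).1 n le_rfl _ = _
  rw [ForallClock.compat]
  rfl

/-! ## Eliminations commute with delays -/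

theorem delay_app (τ : Ty 0) (n : ℕ) (x : τ.den.obj n) :
    (delay τ).app n x = (tick τ).app n ((Hom.next _).app n x) := rfl

theorem delay_fst (σ τ : Ty 0) (n : ℕ) : Function.Semiconj ((Hom.fst σ.den τ.den).app n)
    ((delay (.prod σ τ)).app n) ((delay σ).app n) := by
  intro x
  refine (congrArg (fun p : σ.den.obj n × τ.den.obj n => p.1) (tick_prod σ τ n _)).trans ?_
  cases n <;> rfl

theorem delay_snd (σ τ : Ty 0) (n : ℕ) : Function.Semiconj ((Hom.snd σ.den τ.den).app n)
    ((delay (.prod σ τ)).app n) ((delay τ).app n) := by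
  intro x
  refine (congrArg (fun p : σ.den.obj n × τ.den.obj n => p.2) (tick_prod σ τ n _)).trans ?_
  cases n <;> rfl

theorem delay_ev (σ τ : Ty 0) (n : ℕ) (x : σ.den.obj n) :
    Function.Semiconj (fun f => (Hom.ev σ.den τ.den).app n (f, x))
      ((delay (.arrow σ τ)).app n) ((delay τ).app n) := by
  intro f
  refine (tick_arrow σ τ n _ n le_rfl x).trans ?_
  refine (congrArg (fun g => (tick τ).app n ((Hom.laterApp σ.den τ.den).app n (g, _)))
    ((σ.den.exp τ.den).later.resTo_self _)).trans ?_
  cases n with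
  | zero => rfl
  | succ n => exact congrArg ((tick τ).app (n + 1)) ((Hom.ev σ.den τ.den).nat n (f, x)).symm

theorem delay_unfold (τ : Ty 1) (n : ℕ) :
    Function.Semiconj (((Hom.ofEq (den_mu τ)).comp (tick τ.unroll)).app n)
      ((delay (.mu τ)).app n) ((delay τ.unroll).app n) := by
  intro x
  change (tick τ.unroll).app n ((Hom.ofEq (den_mu τ)).app n ((delay (.mu τ)).app n x)) =
    (delay τ.unroll).app n ((tick τ.unroll).app n ((Hom.ofEq (den_mu τ)).app n x))
  rw [delay_app, delay_app]
  congr 1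
  cases n with
  | zero => rfl
  | succ n =>
    rw [tick_mu]
    change (tick τ.unroll).app n ((Hom.ofEq (den_mu τ)).app n ((Ty.mu τ).den.res n x)) =
      τ.unroll.den.res n _
    rw [Hom.nat, Hom.nat]

theorem delay_hat {Γ : TT} (σ τ₁ τ₂ : Ty 0) (f : Hom (Γ.prod (τ₁.den.sum τ₂.den)) σ.den) (n : ℕ)
    (γ : Γ.obj n) : Function.Semiconj (fun x => (Hom.hat (tick σ) f).app n (γ, x))
      ((delay (.sum τ₁ τ₂)).app n) ((delay σ).app n) := by
  intro x
  refine (congrArg (fun x => (Hom.hat (tick σ) f).app n (γ, x)) (tick_sum τ₁ τ₂ n _)).trans ?_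
  cases n with
  | zero => rfl
  | succ n =>
    exact congrArg ((tick σ).app (n + 1)) ((Hom.hat (tick σ) f).nat n (γ, x)).symm

/-! ## The substitution lemma -/

theorem Hom.app_resTo {X Y : TT} (f : Hom X Y) {k n : ℕ} (h : k ≤ n) (x : X.obj n) :
    f.app k (X.resTo h x) = Y.resTo h (f.app n x) := by
  induction n, h using Nat.le_induction with
  | base => rw [TT.resTo_self, TT.resTo_self]
  | succ n h ih => rw [← X.resTo_res h, ih, ← Y.resTo_res h, f.nat]

theorem Hom.curry_comp {Δ Γ X Y : TT} (e : Hom Δ Γ) {f' : Hom (Δ.prod X) Y} {f : Hom (Γ.prod X) Y}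
    (hf : ∀ n δ x, f'.app n (δ, x) = f.app n (e.app n δ, x)) (n : ℕ) (δ : Δ.obj n) :
    (Hom.curry f').app n δ = (Hom.curry f).app n (e.app n δ) := by
  apply Subtype.ext
  funext k h x
  change f'.app k (Δ.resTo h δ, x) = f.app k (Γ.resTo h (e.app n δ), x)
  exact (hf k _ x).trans (congrArg (fun γ => f.app k (γ, x)) (e.app_resTo h δ))

theorem Hom.hat_comp {Δ Γ X Y : TT} (e : Hom Δ Γ) (θ : Hom Y.later Y) {f' : Hom (Δ.prod X) Y}
    {f : Hom (Γ.prod X) Y} (hf : ∀ n δ x, f'.app n (δ, x) = f.app n (e.app n δ, x)) :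
    ∀ (n : ℕ) (δ : Δ.obj n) (x : X.lift.obj n),
      (Hom.hat θ f').app n (δ, x) = (Hom.hat θ f).app n (e.app n δ, x)
  | 0, δ, Sum.inl x => hf 0 δ x
  | 0, _, Sum.inr _ => rfl
  | n + 1, δ, Sum.inl x => hf (n + 1) δ x
  | n + 1, δ, Sum.inr r => by
    refine congrArg (θ.app (n + 1)) ((Hom.hat_comp e θ hf n (Δ.res n δ) r).trans ?_)
    rw [← e.nat]
    rfl

/-- The weakening `⟦Γ, x : σ⟧ → ⟦Γ⟧`. -/
def weaken {n : ℕ} (Γ : Ctx n) (σ : Ty 0) : Hom (Γ.cons σ).den Γ.den where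
  app _ δ i := δ i.succ
  nat _ _ := rfl

/-- The map `⟦Δ, x : σ⟧ → ⟦Γ, x : σ⟧` induced by a map `⟦Δ⟧ → ⟦Γ⟧`. -/
def liftHom {n m : ℕ} {Δ : Ctx m} {Γ : Ctx n} (e : Hom Δ.den Γ.den) (σ : Ty 0) :
    Hom (Δ.cons σ).den (Γ.cons σ).den where
  app k δ := Fin.cases (δ 0) ((((weaken Δ σ).comp e).app k δ))
  nat k δ := funext fun i =>
    Fin.cases rfl (fun i => congrFun (((weaken Δ σ).comp e).nat k δ) i) i

theorem liftHom_extend {n m : ℕ} {Δ : Ctx m} {Γ : Ctx n} (e : Hom Δ.den Γ.den) (σ : Ty 0) (k : ℕ)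
    (δ : Δ.den.obj k) (x : σ.den.obj k) :
    (liftHom e σ).app k ((extend Δ σ).app k (δ, x)) = (extend Γ σ).app k (e.app k δ, x) :=
  funext fun i => Fin.cases rfl (fun _ => rfl) i

theorem Typing.exists_var {m : ℕ} {Δ : Ctx m} {τ : Ty 0} {j : Fin m} (h : Δ j = τ) :
    ∃ d : Typing Δ (.var j) τ, ∀ k δ, HEq (d.den.app k δ) (δ j) := by
  subst h
  exact ⟨.var j, fun _ _ => HEq.rfl⟩

/-- Some derivation of `Δ ⊢ M' : σ` denotes the composite of `e : ⟦Δ⟧ → ⟦Γ⟧` with the denotation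
of `d`. -/
def Typing.Reindexes {n m : ℕ} {Γ : Ctx n} {Δ : Ctx m} {M : Tm n} {σ : Ty 0} (d : Typing Γ M σ)
    (e : Hom Δ.den Γ.den) (M' : Tm m) : Prop :=
  ∃ d' : Typing Δ M' σ, ∀ k δ, d'.den.app k δ = d.den.app k (e.app k δ)

theorem Typing.Reindexes.lam {n m : ℕ} {Γ : Ctx n} {Δ : Ctx m} {σ τ : Ty 0} {M : Tm (n + 1)}
    {d : Typing (Γ.cons σ) M τ} {e : Hom Δ.den Γ.den} {M' : Tm (m + 1)}
    (h : d.Reindexes (liftHom e σ) M') : d.lam.Reindexes e (.lam σ M') := by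
  obtain ⟨d', hd⟩ := h
  refine ⟨d'.lam, Hom.curry_comp e fun k δ x => ?_⟩
  exact (hd k _).trans (congrArg (d.den.app k) (liftHom_extend e σ k δ x))

theorem Typing.Reindexes.case {n m : ℕ} {Γ : Ctx n} {Δ : Ctx m} {τ₁ τ₂ σ : Ty 0} {L : Tm n}
    {M N : Tm (n + 1)} {d : Typing Γ L (.sum τ₁ τ₂)} {d₁ : Typing (Γ.cons τ₁) M σ}
    {d₂ : Typing (Γ.cons τ₂) N σ} {e : Hom Δ.den Γ.den} {L' : Tm m} {M' N' : Tm (m + 1)}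
    (h : d.Reindexes e L') (h₁ : d₁.Reindexes (liftHom e τ₁) M')
    (h₂ : d₂.Reindexes (liftHom e τ₂) N') : (d.case d₁ d₂).Reindexes e (.case L' M' N') := by
  obtain ⟨d', hd⟩ := h
  obtain ⟨d₁', hd₁⟩ := h₁
  obtain ⟨d₂', hd₂⟩ := h₂
  refine ⟨d'.case d₁' d₂', fun k δ => ?_⟩
  refine (Hom.hat_comp e (tick σ) (f := Hom.cases ((extend Γ τ₁).comp d₁.den)
    ((extend Γ τ₂).comp d₂.den)) ?_ k δ _).trans ?_
  · rintro k δ (x | x)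
    · exact (hd₁ k _).trans (congrArg (d₁.den.app k) (liftHom_extend e τ₁ k δ x))
    · exact (hd₂ k _).trans (congrArg (d₂.den.app k) (liftHom_extend e τ₂ k δ x))
  · exact congrArg (fun x => (Hom.hat (tick σ) _).app k (e.app k δ, x)) (hd k δ)

theorem Typing.Reindexes.inl {n m : ℕ} {Γ : Ctx n} {Δ : Ctx m} {τ₁ τ₂ : Ty 0} {M : Tm n}
    {d : Typing Γ M τ₁} {e : Hom Δ.den Γ.den} {M' : Tm m} (h : d.Reindexes e M') :
    (d.inl (τ₂ := τ₂)).Reindexes e (.inl M') := by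
  obtain ⟨a, ha⟩ := h
  exact ⟨a.inl, fun k δ => congrArg (((Hom.inl _ _).comp (Hom.now _)).app k) (ha k δ)⟩

theorem Typing.Reindexes.inr {n m : ℕ} {Γ : Ctx n} {Δ : Ctx m} {τ₁ τ₂ : Ty 0} {M : Tm n}
    {d : Typing Γ M τ₂} {e : Hom Δ.den Γ.den} {M' : Tm m} (h : d.Reindexes e M') :
    (d.inr (τ₁ := τ₁)).Reindexes e (.inr M') := by
  obtain ⟨a, ha⟩ := h
  exact ⟨a.inr, fun k δ => congrArg (((Hom.inr _ _).comp (Hom.now _)).app k) (ha k δ)⟩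

theorem Typing.Reindexes.fst {n m : ℕ} {Γ : Ctx n} {Δ : Ctx m} {τ₁ τ₂ : Ty 0} {M : Tm n}
    {d : Typing Γ M (.prod τ₁ τ₂)} {e : Hom Δ.den Γ.den} {M' : Tm m} (h : d.Reindexes e M') :
    (d.fst).Reindexes e (.fst M') := by
  obtain ⟨a, ha⟩ := h
  exact ⟨a.fst, fun k δ => congrArg ((Hom.fst _ _).app k) (ha k δ)⟩

theorem Typing.Reindexes.snd {n m : ℕ} {Γ : Ctx n} {Δ : Ctx m} {τ₁ τ₂ : Ty 0} {M : Tm n}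
    {d : Typing Γ M (.prod τ₁ τ₂)} {e : Hom Δ.den Γ.den} {M' : Tm m} (h : d.Reindexes e M') :
    (d.snd).Reindexes e (.snd M') := by
  obtain ⟨a, ha⟩ := h
  exact ⟨a.snd, fun k δ => congrArg ((Hom.snd _ _).app k) (ha k δ)⟩

theorem Typing.Reindexes.unfold {n m : ℕ} {Γ : Ctx n} {Δ : Ctx m} {τ : Ty 1} {M : Tm n}
    {d : Typing Γ M (.mu τ)} {e : Hom Δ.den Γ.den} {M' : Tm m} (h : d.Reindexes e M') :
    (d.unfold).Reindexes e (.unfold M') := by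
  obtain ⟨a, ha⟩ := h
  exact ⟨a.unfold, fun k δ => congrArg (((Hom.ofEq (den_mu _)).comp (tick _)).app k) (ha k δ)⟩

theorem Typing.Reindexes.fold {n m : ℕ} {Γ : Ctx n} {Δ : Ctx m} {τ : Ty 1} {M : Tm n}
    {d : Typing Γ M τ.unroll} {e : Hom Δ.den Γ.den} {M' : Tm m} (h : d.Reindexes e M') :
    (d.fold).Reindexes e (.fold M') := by
  obtain ⟨a, ha⟩ := h
  exact ⟨a.fold, fun k δ => congrArg (((Hom.next _).comp (Hom.ofEq (den_mu _).symm)).app k) (ha k δ)⟩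

theorem Typing.Reindexes.app {n m : ℕ} {Γ : Ctx n} {Δ : Ctx m} {σ τ : Ty 0} {M N : Tm n}
    {d₁ : Typing Γ M (.arrow σ τ)} {d₂ : Typing Γ N σ} {e : Hom Δ.den Γ.den} {M' N' : Tm m}
    (h₁ : d₁.Reindexes e M') (h₂ : d₂.Reindexes e N') :
    (d₁.app d₂).Reindexes e (.app M' N') := by
  obtain ⟨a, ha⟩ := h₁
  obtain ⟨b, hb⟩ := h₂
  exact ⟨a.app b, fun k δ => congrArg₂ (fun x y => (Hom.ev _ _).app k (x, y)) (ha k δ) (hb k δ)⟩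

theorem Typing.Reindexes.pair {n m : ℕ} {Γ : Ctx n} {Δ : Ctx m} {σ τ : Ty 0} {M N : Tm n}
    {d₁ : Typing Γ M σ} {d₂ : Typing Γ N τ} {e : Hom Δ.den Γ.den} {M' N' : Tm m}
    (h₁ : d₁.Reindexes e M') (h₂ : d₂.Reindexes e N') :
    (d₁.pair d₂).Reindexes e (.pair M' N') := by
  obtain ⟨a, ha⟩ := h₁
  obtain ⟨b, hb⟩ := h₂
  exact ⟨a.pair b, fun k δ => Prod.ext (ha k δ) (hb k δ)⟩

theorem Typing.reindexes_rename {n : ℕ} {Γ : Ctx n} {M : Tm n} {σ : Ty 0} (d : Typing Γ M σ) :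
    ∀ {m : ℕ} {Δ : Ctx m} (r : Fin n → Fin m) (e : Hom Δ.den Γ.den),
      (∀ i, Δ (r i) = Γ i ∧ ∀ k (δ : Δ.den.obj k), HEq (δ (r i)) (e.app k δ i)) →
      d.Reindexes e (M.rename r) := by
  have lift {n m : ℕ} {Γ : Ctx n} {Δ : Ctx m} {r : Fin n → Fin m} {e : Hom Δ.den Γ.den} (σ : Ty 0)
      (h : ∀ i, Δ (r i) = Γ i ∧ ∀ k (δ : Δ.den.obj k), HEq (δ (r i)) (e.app k δ i)) (i) :
      (Δ.cons σ) (liftRen r i) = (Γ.cons σ) i ∧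
        ∀ k (δ : (Δ.cons σ).den.obj k), HEq (δ (liftRen r i)) ((liftHom e σ).app k δ i) :=
    Fin.cases ⟨rfl, fun _ _ => HEq.rfl⟩
      (fun i => ⟨(h i).1, fun k δ => (h i).2 k fun j => δ j.succ⟩) i
  induction d with
  | var i =>
    intro m Δ r e h
    obtain ⟨d', hd⟩ := Typing.exists_var (h i).1
    exact ⟨d', fun k δ => eq_of_heq ((hd k δ).trans ((h i).2 k δ))⟩
  | unit => exact fun _ _ h => ⟨.unit, fun _ _ => rfl⟩
  | lam d ih => exact fun _ _ h => (ih _ _ (lift _ h)).lam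
  | app d d₁ ih ih₁ => exact fun _ _ h => (ih _ _ h).app (ih₁ _ _ h)
  | pair d d₁ ih ih₁ => exact fun _ _ h => (ih _ _ h).pair (ih₁ _ _ h)
  | case d d₁ d₂ ih ih₁ ih₂ =>
    exact fun _ _ h => (ih _ _ h).case (ih₁ _ _ (lift _ h)) (ih₂ _ _ (lift _ h))
  | inl d ih => exact fun _ _ h => (ih _ _ h).inl
  | inr d ih => exact fun _ _ h => (ih _ _ h).inr
  | fst d ih => exact fun _ _ h => (ih _ _ h).fst
  | snd d ih => exact fun _ _ h => (ih _ _ h).snd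
  | unfold d ih => exact fun _ _ h => (ih _ _ h).unfold
  | fold d ih => exact fun _ _ h => (ih _ _ h).fold

/-- The morphism `e : ⟦Δ⟧ → ⟦Γ⟧` is the denotation of the substitution `s`. -/
def Realizes {n m : ℕ} {Γ : Ctx n} {Δ : Ctx m} (s : Fin n → Tm m) (e : Hom Δ.den Γ.den) : Prop :=
  ∀ i, ∃ d : Typing Δ (s i) (Γ i), ∀ k δ, d.den.app k δ = e.app k δ i

/-- Substitution lemma for terms. -/
theorem Typing.reindexes_subst {n : ℕ} {Γ : Ctx n} {M : Tm n} {σ : Ty 0} (d : Typing Γ M σ) :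
    ∀ {m : ℕ} {Δ : Ctx m} (s : Fin n → Tm m) (e : Hom Δ.den Γ.den),
      Realizes s e → d.Reindexes e (M.subst s) := by
  have lift {n m : ℕ} {Γ : Ctx n} {Δ : Ctx m} {s : Fin n → Tm m} {e : Hom Δ.den Γ.den} (σ : Ty 0)
      (h : Realizes s e) : Realizes (Tm.liftSub s) (liftHom e σ) := by
    refine fun i => Fin.cases ⟨.var 0, fun _ _ => rfl⟩ (fun i => ?_) i
    obtain ⟨d, hd⟩ := h i
    obtain ⟨d', hd'⟩ := d.reindexes_rename Fin.succ (weaken Δ σ) fun i => ⟨rfl, fun _ _ => HEq.rfl⟩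
    exact ⟨d', fun k δ => (hd' k δ).trans (hd k _)⟩
  induction d with
  | var i =>
    exact fun _ _ h => h i
  | unit => exact fun _ _ h => ⟨.unit, fun _ _ => rfl⟩
  | lam d ih => exact fun _ _ h => (ih _ _ (lift _ h)).lam
  | app d d₁ ih ih₁ => exact fun _ _ h => (ih _ _ h).app (ih₁ _ _ h)
  | pair d d₁ ih ih₁ => exact fun _ _ h => (ih _ _ h).pair (ih₁ _ _ h)
  | case d d₁ d₂ ih ih₁ ih₂ =>
    exact fun _ _ h => (ih _ _ h).case (ih₁ _ _ (lift _ h)) (ih₂ _ _ (lift _ h))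
  | inl d ih => exact fun _ _ h => (ih _ _ h).inl
  | inr d ih => exact fun _ _ h => (ih _ _ h).inr
  | fst d ih => exact fun _ _ h => (ih _ _ h).fst
  | snd d ih => exact fun _ _ h => (ih _ _ h).snd
  | unfold d ih => exact fun _ _ h => (ih _ _ h).unfold
  | fold d ih => exact fun _ _ h => (ih _ _ h).fold

/-- Substitution lemma for terms, for a single variable. -/
theorem Typing.exists_inst {n : ℕ} {Γ : Ctx n} {σ τ : Ty 0} {M : Tm (n + 1)} {N : Tm n}
    (d : Typing (Γ.cons σ) M τ) (d₁ : Typing Γ N σ) :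
    ∃ d' : Typing Γ (M.inst N) τ, ∀ k γ,
      d'.den.app k γ = d.den.app k ((extend Γ σ).app k (γ, d₁.den.app k γ)) :=
  d.reindexes_subst _ ((Hom.pair (Hom.id Γ.den) d₁.den).comp (extend Γ σ)) fun i =>
    Fin.cases ⟨d₁, fun _ _ => rfl⟩ (fun i => ⟨.var i, fun _ _ => rfl⟩) i

/-! ## Soundness -/

/-- If `M ⇓ᵏ v` then `⟦M⟧ = δᵏ ⟦v⟧`. -/
theorem BigStep.sound {M v : Tm 0} {k : ℕ} (h : BigStep M k v) :
    ∀ {σ : Ty 0} (d : Typing Ctx.nil M σ), ∃ d' : Typing Ctx.nil v σ, ∀ n γ,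
      d.den.app n γ = ((delay σ).app n)^[k] (d'.den.app n γ) := by
  induction h with
  | value _ => exact fun d => ⟨d, fun _ _ => rfl⟩
  | @caseInl L L' M N k m v _ _ ih₁ ih₂ =>
    intro σ d
    cases d with
    | @case _ _ τ₁ τ₂ _ _ _ _ d d₁ d₂ =>
    obtain ⟨d', hd⟩ := ih₁ d
    cases d' with
    | inl d' =>
    obtain ⟨e, he⟩ := d₁.exists_inst d'
    obtain ⟨w, hw⟩ := ih₂ e
    refine ⟨w, fun n γ => ?_⟩
    rw [add_comm, Function.iterate_add_apply, ← hw, he]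
    let f := Hom.cases ((extend _ τ₁).comp d₁.den) ((extend _ τ₂).comp d₂.den)
    refine (congrArg (fun x => (Hom.hat (tick σ) f).app n (γ, x)) (hd n γ)).trans ?_
    refine ((delay_hat σ τ₁ τ₂ f n γ).iterate_right k _).trans
      (congrArg _ ?_)
    cases n <;> rfl
  | @caseInr L L' M N k m v _ _ ih₁ ih₂ =>
    intro σ d
    cases d with
    | @case _ _ τ₁ τ₂ _ _ _ _ d d₁ d₂ =>
    obtain ⟨d', hd⟩ := ih₁ d
    cases d' with
    | inr d' =>
    obtain ⟨e, he⟩ := d₂.exists_inst d'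
    obtain ⟨w, hw⟩ := ih₂ e
    refine ⟨w, fun n γ => ?_⟩
    rw [add_comm, Function.iterate_add_apply, ← hw, he]
    let f := Hom.cases ((extend _ τ₁).comp d₁.den) ((extend _ τ₂).comp d₂.den)
    refine (congrArg (fun x => (Hom.hat (tick σ) f).app n (γ, x)) (hd n γ)).trans ?_
    refine ((delay_hat σ τ₁ τ₂ f n γ).iterate_right k _).trans
      (congrArg _ ?_)
    cases n <;> rfl
  | @fst L M N k l v _ _ ih₁ ih₂ =>
    intro σ d
    cases d with
    | fst d =>
    obtain ⟨d', hd⟩ := ih₁ d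
    cases d' with
    | pair d₁ d₂ =>
    obtain ⟨w, hw⟩ := ih₂ d₁
    refine ⟨w, fun n γ => ?_⟩
    rw [Function.iterate_add_apply, ← hw]
    refine (congrArg ((Hom.fst _ _).app n) (hd n γ)).trans ?_
    exact (delay_fst _ _ n).iterate_right k _
  | @snd L M N k l v _ _ ih₁ ih₂ =>
    intro σ d
    cases d with
    | snd d =>
    obtain ⟨d', hd⟩ := ih₁ d
    cases d' with
    | pair d₁ d₂ =>
    obtain ⟨w, hw⟩ := ih₂ d₂
    refine ⟨w, fun n γ => ?_⟩
    rw [Function.iterate_add_apply, ← hw]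
    refine (congrArg ((Hom.snd _ _).app n) (hd n γ)).trans ?_
    exact (delay_snd _ _ n).iterate_right k _
  | @app M N σ' L k l v _ _ ih₁ ih₂ =>
    intro σ d
    cases d with
    | app d d₁ =>
    obtain ⟨d', hd⟩ := ih₁ d
    cases d' with
    | lam d' =>
    obtain ⟨e, he⟩ := d'.exists_inst d₁
    obtain ⟨w, hw⟩ := ih₂ e
    refine ⟨w, fun n γ => ?_⟩
    rw [Function.iterate_add_apply, ← hw, he]
    refine (congrArg (fun f => (Hom.ev _ _).app n (f, d₁.den.app n γ)) (hd n γ)).trans ?_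
    refine ((delay_ev _ σ n (d₁.den.app n γ)).iterate_right k _).trans (congrArg _ ?_)
    exact congrArg (fun γ => d'.den.app n ((extend _ _).app n (γ, _))) (TT.resTo_self _ γ)
  | @unfold M N k m v _ _ ih₁ ih₂ =>
    intro σ d
    cases d with
    | @unfold _ _ τ _ d =>
    obtain ⟨d', hd⟩ := ih₁ d
    cases d' with
    | fold d' =>
    obtain ⟨w, hw⟩ := ih₂ d'
    refine ⟨w, fun n γ => ?_⟩
    rw [add_assoc, add_comm m, Function.iterate_add_apply, Function.iterate_add_apply, ← hw]
    refine (congrArg (((Hom.ofEq (den_mu τ)).comp (tick _)).app n) (hd n γ)).trans ?_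
    refine ((delay_unfold τ n).iterate_right k _).trans (congrArg _ ?_)
    exact congrArg ((tick _).app n) (Hom.ofEq_symm_app (den_mu τ) n _)

/-! ## Small-step reduction -/

/-- `Red M k M'`: `M` reduces to `M'` in call-by-name steps, `k` of them unfold-fold reductions. -/
inductive Red : Tm 0 → ℕ → Tm 0 → Prop
  | refl (M : Tm 0) : Red M 0 M
  | trans {L M N : Tm 0} {k l : ℕ} : Red L k M → Red M l N → Red L (k + l) N
  | caseInl (L : Tm 0) (M N : Tm 1) : Red (.case (.inl L) M N) 0 (M.inst L)
  | caseInr (L : Tm 0) (M N : Tm 1) : Red (.case (.inr L) M N) 0 (N.inst L)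
  | fstPair (M N : Tm 0) : Red (.fst (.pair M N)) 0 M
  | sndPair (M N : Tm 0) : Red (.snd (.pair M N)) 0 N
  | beta (σ : Ty 0) (M : Tm 1) (N : Tm 0) : Red (.app (.lam σ M) N) 0 (M.inst N)
  | unfoldFold (M : Tm 0) : Red (.unfold (.fold M)) 1 M
  | case {L L' : Tm 0} {k : ℕ} (M N : Tm 1) : Red L k L' → Red (.case L M N) k (.case L' M N)
  | fst {M M' : Tm 0} {k : ℕ} : Red M k M' → Red (.fst M) k (.fst M')
  | snd {M M' : Tm 0} {k : ℕ} : Red M k M' → Red (.snd M) k (.snd M')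
  | app {M M' : Tm 0} {k : ℕ} (N : Tm 0) : Red M k M' → Red (.app M N) k (.app M' N)
  | unfold {M M' : Tm 0} {k : ℕ} : Red M k M' → Red (.unfold M) k (.unfold M')

theorem BigStep.of_red {M M' : Tm 0} {k : ℕ} (h : Red M k M') :
    ∀ {l : ℕ} {v : Tm 0}, BigStep M' l v → BigStep M (k + l) v := by
  have cast : ∀ {M v : Tm 0} {k l : ℕ}, k = l → BigStep M k v → BigStep M l v := by
    rintro M v k _ rfl h
    exact h
  induction h with
  | refl M => exact fun h => cast (by omega) h
  | trans _ _ ih₁ ih₂ => exact fun h => cast (by omega) (ih₁ (ih₂ h))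
  | caseInl L M N => exact fun h => cast (by omega) (.caseInl (.value (.inl L)) h)
  | caseInr L M N => exact fun h => cast (by omega) (.caseInr (.value (.inr L)) h)
  | fstPair M N => exact fun h => cast (by omega) (.fst (.value (.pair M N)) h)
  | sndPair M N => exact fun h => cast (by omega) (.snd (.value (.pair M N)) h)
  | beta σ M N => exact fun h => cast (by omega) (.app (.value (.lam σ M)) h)
  | unfoldFold M => exact fun h => cast (by omega) (.unfold (.value (.fold M)) h)
  | case M N _ ih =>
    intro l v h
    cases h with
    | value h => cases h
    | caseInl h₁ h₂ => exact cast (by omega) (.caseInl (ih h₁) h₂)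
    | caseInr h₁ h₂ => exact cast (by omega) (.caseInr (ih h₁) h₂)
  | fst _ ih =>
    intro l v h
    cases h with
    | value h => cases h
    | fst h₁ h₂ => exact cast (by omega) (.fst (ih h₁) h₂)
  | snd _ ih =>
    intro l v h
    cases h with
    | value h => cases h
    | snd h₁ h₂ => exact cast (by omega) (.snd (ih h₁) h₂)
  | app N _ ih =>
    intro l v h
    cases h with
    | value h => cases h
    | app h₁ h₂ => exact cast (by omega) (.app (ih h₁) h₂)
  | unfold _ ih =>
    intro l v h
    cases h with
    | value h => cases h
    | unfold h₁ h₂ => exact cast (by omega) (.unfold (ih h₁) h₂)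

/-! ## The logical relation -/

/-- The logical relation between stage `n` of `⟦τ⟧` and closed terms. -/
def Rel : (n : ℕ) → (τ : Ty 0) → τ.den.obj n → Tm 0 → Prop
  | 0, .one, x, M => match (show Unit ⊕ Unit from x) with
    | .inl _ => Red M 0 .unit
    | .inr _ => True
  | n + 1, .one, x, M => match (show Unit ⊕ TT.one.lift.obj n from x) with
    | .inl _ => Red M 0 .unit
    | .inr r => ∃ M', Red M 1 M' ∧ Rel n .one r M'
  | n, .prod σ τ, x, M =>
      Rel n σ (show σ.den.obj n × τ.den.obj n from x).1 (.fst M) ∧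
        Rel n τ (show σ.den.obj n × τ.den.obj n from x).2 (.snd M)
  | 0, .sum σ τ, x, M => match (show (σ.den.obj 0 ⊕ τ.den.obj 0) ⊕ Unit from x) with
    | .inl (.inl a) => ∃ M', Red M 0 (.inl M') ∧ Rel 0 σ a M'
    | .inl (.inr b) => ∃ M', Red M 0 (.inr M') ∧ Rel 0 τ b M'
    | .inr _ => True
  | n + 1, .sum σ τ, x, M =>
    match (show (σ.den.obj (n + 1) ⊕ τ.den.obj (n + 1)) ⊕ (Ty.sum σ τ).den.obj n from x) with
    | .inl (.inl a) => ∃ M', Red M 0 (.inl M') ∧ Rel (n + 1) σ a M'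
    | .inl (.inr b) => ∃ M', Red M 0 (.inr M') ∧ Rel (n + 1) τ b M'
    | .inr r => ∃ M', Red M 1 M' ∧ Rel n (.sum σ τ) r M'
  | n, .arrow σ τ, f, M => ∀ k (h : k ≤ n) (x : σ.den.obj k) N, Rel k σ x N →
      Rel k τ ((show (σ.den.exp τ.den).obj n from f).1 k h x) (.app M N)
  | 0, .mu _, _, _ => True
  | n + 1, .mu τ, x, M => ∃ M', Red (.unfold M) 1 M' ∧
      Rel n τ.unroll ((Hom.ofEq (den_mu τ)).app (n + 1) x) M'
termination_by n τ => (n, sizeOf τ)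
decreasing_by
  all_goals first
    | decreasing_tactic
    | rcases h.lt_or_eq with h | rfl
      · exact Prod.Lex.left _ _ h
      · decreasing_tactic


/-- The relation on `▷⟦τ⟧`: it holds one stage and one unfold-fold reduction later. -/
def LaterRel : (n : ℕ) → (τ : Ty 0) → τ.den.later.obj n → Tm 0 → Prop
  | 0, _, _, _ => True
  | n + 1, τ, r, M => ∃ M', Red M 1 M' ∧ Rel n τ r M'

namespace Rel

theorem one_now {n : ℕ} {a : TT.one.obj n} {M : Tm 0} :
    Rel n .one ((Hom.now TT.one).app n a) M ↔ Red M 0 .unit := by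
  cases n <;> exact Iff.of_eq (Rel.eq_def ..)

theorem one_tickLift {n : ℕ} {r : (Ty.den .one).later.obj n} {M : Tm 0} :
    Rel n .one ((Hom.tickLift TT.one).app n r) M ↔ LaterRel n .one r M := by
  cases n <;> exact Iff.of_eq (Rel.eq_def ..)

theorem prod {n : ℕ} {σ τ : Ty 0} {x : σ.den.obj n × τ.den.obj n} {M : Tm 0} :
    Rel n (.prod σ τ) x M ↔ Rel n σ x.1 (.fst M) ∧ Rel n τ x.2 (.snd M) := by
  cases n <;> exact Iff.of_eq (Rel.eq_def ..)

theorem sum_inl {n : ℕ} {σ τ : Ty 0} {a : σ.den.obj n} {M : Tm 0} :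
    Rel n (.sum σ τ) ((Hom.now (σ.den.sum τ.den)).app n (.inl a)) M ↔
      ∃ M', Red M 0 (.inl M') ∧ Rel n σ a M' := by
  cases n <;> exact Iff.of_eq (Rel.eq_def ..)

theorem sum_inr {n : ℕ} {σ τ : Ty 0} {b : τ.den.obj n} {M : Tm 0} :
    Rel n (.sum σ τ) ((Hom.now (σ.den.sum τ.den)).app n (.inr b)) M ↔
      ∃ M', Red M 0 (.inr M') ∧ Rel n τ b M' := by
  cases n <;> exact Iff.of_eq (Rel.eq_def ..)

theorem sum_tickLift {n : ℕ} {σ τ : Ty 0} {r : (Ty.den (.sum σ τ)).later.obj n} {M : Tm 0} :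
    Rel n (.sum σ τ) ((Hom.tickLift (σ.den.sum τ.den)).app n r) M ↔
      LaterRel n (.sum σ τ) r M := by
  cases n <;> exact Iff.of_eq (Rel.eq_def ..)

theorem arrow {n : ℕ} {σ τ : Ty 0} {f : (σ.den.exp τ.den).obj n} {M : Tm 0} :
    Rel n (.arrow σ τ) f M ↔ ∀ k (h : k ≤ n) (x : σ.den.obj k) N, Rel k σ x N →
      Rel k τ (f.1 k h x) (.app M N) := by
  cases n <;> exact Iff.of_eq (Rel.eq_def ..)

theorem mu {n : ℕ} {τ : Ty 1} {x : (Ty.mu τ).den.obj n} {M : Tm 0} :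
    Rel n (.mu τ) x M ↔ LaterRel n τ.unroll ((Hom.ofEq (den_mu τ)).app n x) (.unfold M) := by
  cases n <;> exact Iff.of_eq (Rel.eq_def ..)

end Rel

theorem TT.lift_cases {X : TT} {n : ℕ} (x : X.lift.obj n) :
    (∃ a, x = (Hom.now X).app n a) ∨ ∃ r, x = (Hom.tickLift X).app n r := by
  match n, x with
  | 0, .inl a => exact .inl ⟨a, rfl⟩
  | 0, .inr r => exact .inr ⟨r, rfl⟩
  | _ + 1, .inl a => exact .inl ⟨a, rfl⟩
  | _ + 1, .inr r => exact .inr ⟨r, rfl⟩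

theorem LaterRel.of_red {n : ℕ} {τ : Ty 0} {r : τ.den.later.obj n} {M M' : Tm 0} (hM : Red M 0 M')
    (h : LaterRel n τ r M') : LaterRel n τ r M := by
  cases n with
  | zero => trivial
  | succ n =>
    obtain ⟨N, hN, h⟩ := h
    exact ⟨N, hM.trans hN, h⟩

/-- The logical relation is closed under expansion of terms. -/
theorem Rel.of_red {τ : Ty 0} {n : ℕ} {x : τ.den.obj n} {M M' : Tm 0} (r : Red M 0 M')
    (h : Rel n τ x M') : Rel n τ x M := by
  match τ, x, h with
  | .one, x, h =>
    obtain ⟨a, rfl⟩ | ⟨y, rfl⟩ := TT.lift_cases x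
    · exact one_now.mpr (r.trans (one_now.mp h))
    · exact one_tickLift.mpr (.of_red r (one_tickLift.mp h))
  | .prod σ τ, x, h => exact prod.mpr ⟨of_red r.fst (prod.mp h).1, of_red r.snd (prod.mp h).2⟩
  | .sum σ τ, x, h =>
    obtain ⟨a | b, rfl⟩ | ⟨y, rfl⟩ := TT.lift_cases x
    · obtain ⟨N, hN, h⟩ := sum_inl.mp h
      exact sum_inl.mpr ⟨N, r.trans hN, h⟩
    · obtain ⟨N, hN, h⟩ := sum_inr.mp h
      exact sum_inr.mpr ⟨N, r.trans hN, h⟩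
    · exact sum_tickLift.mpr (.of_red r (sum_tickLift.mp h))
  | .arrow σ τ, x, h =>
    exact arrow.mpr fun k hk y N hy => of_red (r.app N) (arrow.mp h k hk y N hy)
  | .mu τ, x, h => exact mu.mpr (.of_red r.unfold (mu.mp h))
termination_by sizeOf τ

theorem LaterRel.res_of {n : ℕ} {τ : Ty 0}
    (hn : ∀ m < n, ∀ (x : τ.den.obj (m + 1)) (M : Tm 0), Rel (m + 1) τ x M →
      Rel m τ (τ.den.res m x) M)
    {r : τ.den.later.obj (n + 1)} {M : Tm 0} (h : LaterRel (n + 1) τ r M) :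
    LaterRel n τ (τ.den.later.res n r) M := by
  cases n with
  | zero => trivial
  | succ n =>
    obtain ⟨N, hN, h⟩ := h
    exact ⟨N, hN, hn n (Nat.lt_succ_self n) _ _ h⟩

/-- The logical relation is closed under restriction. -/
theorem Rel.res {n : ℕ} {τ : Ty 0} {x : τ.den.obj (n + 1)} {M : Tm 0}
    (h : Rel (n + 1) τ x M) : Rel n τ (τ.den.res n x) M := by
  match τ, x, h with
  | .one, x, h =>
    obtain ⟨a, rfl⟩ | ⟨y, rfl⟩ := TT.lift_cases x
    · exact ((Hom.now TT.one).nat n a).symm ▸ one_now.mpr (one_now.mp h)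
    · exact ((Hom.tickLift TT.one).nat n y).symm ▸
        one_tickLift.mpr (.res_of (fun m _ _ _ => res) (one_tickLift.mp h))
  | .prod σ τ, x, h => exact prod.mpr ⟨res (prod.mp h).1, res (prod.mp h).2⟩
  | .sum σ τ, x, h =>
    obtain ⟨a | b, rfl⟩ | ⟨y, rfl⟩ := TT.lift_cases x
    · obtain ⟨N, hN, h⟩ := sum_inl.mp h
      exact ((Hom.now (σ.den.sum τ.den)).nat n (.inl a)).symm ▸ sum_inl.mpr ⟨N, hN, res h⟩
    · obtain ⟨N, hN, h⟩ := sum_inr.mp h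
      exact ((Hom.now (σ.den.sum τ.den)).nat n (.inr b)).symm ▸ sum_inr.mpr ⟨N, hN, res h⟩
    · exact ((Hom.tickLift (σ.den.sum τ.den)).nat n y).symm ▸
        sum_tickLift.mpr (.res_of (fun m _ _ _ => res) (sum_tickLift.mp h))
  | .arrow σ τ, x, h => exact arrow.mpr fun k hk => arrow.mp h k (hk.trans (Nat.le_succ n))
  | .mu τ, x, h =>
    refine mu.mpr ?_
    rw [← Hom.nat]
    exact .res_of (fun m _ _ _ => res) (mu.mp h)
termination_by (n, sizeOf τ)

theorem LaterRel.next {n : ℕ} {τ : Ty 0} {x : τ.den.obj n} {M M' : Tm 0} (r : Red M 1 M')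
    (h : Rel n τ x M') : LaterRel n τ ((Hom.next τ.den).app n x) M := by
  cases n with
  | zero => trivial
  | succ n => exact ⟨M', r, h.res⟩

theorem LaterRel.fst {n : ℕ} {σ τ : Ty 0} {r : (Ty.den (.prod σ τ)).later.obj n} {M : Tm 0}
    (h : LaterRel n (.prod σ τ) r M) :
    LaterRel n σ ((Hom.laterMap (Hom.fst σ.den τ.den)).app n r) (.fst M) := by
  cases n with
  | zero => trivial
  | succ n =>
    obtain ⟨N, hN, h⟩ := h
    exact ⟨_, hN.fst, (Rel.prod.mp h).1⟩

theorem LaterRel.snd {n : ℕ} {σ τ : Ty 0} {r : (Ty.den (.prod σ τ)).later.obj n} {M : Tm 0}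
    (h : LaterRel n (.prod σ τ) r M) :
    LaterRel n τ ((Hom.laterMap (Hom.snd σ.den τ.den)).app n r) (.snd M) := by
  cases n with
  | zero => trivial
  | succ n =>
    obtain ⟨N, hN, h⟩ := h
    exact ⟨_, hN.snd, (Rel.prod.mp h).2⟩

theorem LaterRel.app {n k : ℕ} {σ τ : Ty 0} {r : (Ty.den (.arrow σ τ)).later.obj n} {M : Tm 0}
    (h : LaterRel n (.arrow σ τ) r M) (hk : k ≤ n) {x : σ.den.obj k} {N : Tm 0}
    (hx : Rel k σ x N) :
    LaterRel k τ ((Hom.laterApp σ.den τ.den).app k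
      ((σ.den.exp τ.den).later.resTo hk r, (Hom.next σ.den).app k x)) (.app M N) := by
  match n, k, r, h, hk, x, hx with
  | _, 0, _, _, _, _, _ => trivial
  | n + 1, k + 1, r, h, hk, x, hx =>
    obtain ⟨M', hM, h⟩ := h
    have hk' := Nat.le_of_succ_le_succ hk
    refine ⟨_, hM.app N, ?_⟩
    refine (congrArg (fun y => Rel k τ y (.app M' N)) ?_).mpr (Rel.arrow.mp h k hk' _ N hx.res)
    refine (congrArg (fun g : (σ.den.exp τ.den).obj k => g.1 k le_rfl (σ.den.res k x))
      (TT.later_resTo_succ (X := σ.den.exp τ.den) hk' r)).trans ?_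
    exact TT.exp_resTo hk' _ k le_rfl _

/-- The maps `θ` preserve the logical relation. -/
theorem Rel.tick {n : ℕ} {τ : Ty 0} {r : τ.den.later.obj n} {M : Tm 0} (h : LaterRel n τ r M) :
    Rel n τ ((FPC.tick τ).app n r) M := by
  match τ, r, h with
  | .one, r, h => exact tick_one n r ▸ one_tickLift.mpr h
  | .prod σ τ, r, h => exact tick_prod σ τ n r ▸ prod.mpr ⟨tick h.fst, tick h.snd⟩
  | .sum σ τ, r, h => exact tick_sum σ τ n r ▸ sum_tickLift.mpr h
  | .arrow σ τ, r, h =>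
    refine arrow.mpr fun k hk x N hx => ?_
    exact (congrArg (fun y => Rel k τ y (.app M N)) (tick_arrow σ τ n r k hk x)).mpr
      (tick (h.app hk hx))
  | .mu τ, r, h =>
    refine mu.mpr ?_
    match n, r, h with
    | 0, _, _ => trivial
    | n + 1, r, h =>
      obtain ⟨M', hM, h⟩ := h
      refine ⟨_, hM.unfold, ?_⟩
      rw [tick_mu]
      exact tick (mu.mp h)
termination_by (n, sizeOf τ)
decreasing_by
  all_goals first
    | decreasing_tactic
    | rcases hk.lt_or_eq with h | rfl
      · exact Prod.Lex.left _ _ h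
      · decreasing_tactic

theorem Rel.hat {Γ : TT} {σ τ₁ τ₂ : Ty 0} {f : Hom (Γ.prod τ₁.den) σ.den}
    {g : Hom (Γ.prod τ₂.den) σ.den} {M N : Tm 1} {n : ℕ} {γ : Γ.obj n}
    {x : (Ty.sum τ₁ τ₂).den.obj n} {L : Tm 0}
    (hf : ∀ k (h : k ≤ n) y L', Rel k τ₁ y L' →
      Rel k σ (f.app k (Γ.resTo h γ, y)) (M.inst L'))
    (hg : ∀ k (h : k ≤ n) y L', Rel k τ₂ y L' →
      Rel k σ (g.app k (Γ.resTo h γ, y)) (N.inst L'))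
    (h : Rel n (.sum τ₁ τ₂) x L) :
    Rel n σ ((Hom.hat (X := τ₁.den.sum τ₂.den) (FPC.tick σ) (Hom.cases f g)).app n (γ, x))
      (.case L M N) := by
  induction n using Nat.strong_induction_on generalizing L with | _ n ih =>
  have now : ∀ z, (Hom.hat (FPC.tick σ) (Hom.cases f g)).app n (γ, (Hom.now _).app n z) =
      (Hom.cases f g).app n (γ, z) := by
    intro z
    cases n <;> rfl
  obtain ⟨y | y, rfl⟩ | ⟨y, rfl⟩ := TT.lift_cases x
  · obtain ⟨L, hL, h⟩ := sum_inl.mp h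
    have := hf n le_rfl y L h
    rw [TT.resTo_self] at this
    exact (now (.inl y)).symm ▸ this.of_red ((hL.case M N).trans (.caseInl L M N))
  · obtain ⟨L, hL, h⟩ := sum_inr.mp h
    have := hg n le_rfl y L h
    rw [TT.resTo_self] at this
    exact (now (.inr y)).symm ▸ this.of_red ((hL.case M N).trans (.caseInr L M N))
  · replace h := sum_tickLift.mp h
    match n, γ, y, hf, hg, h, ih with
    | 0, _, _, _, _, _, _ => exact tick (n := 0) (r := ()) trivial
    | n + 1, γ, y, hf, hg, h, ih =>
      obtain ⟨L, hL, h⟩ := h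
      refine tick (n := n + 1) ⟨_, hL.case M N, ?_⟩
      refine ih n (Nat.lt_succ_self n) (γ := Γ.res n γ) (fun k hk z L' hz => ?_) (fun k hk z L' hz => ?_) h
      · rw [Γ.resTo_res]
        exact hf k _ z L' hz
      · rw [Γ.resTo_res]
        exact hg k _ z L' hz

/-! ## Composition of term substitutions -/

theorem Tm.rename_rename {n : ℕ} (M : Tm n) : ∀ {m k : ℕ} (r : Fin n → Fin m) (r' : Fin m → Fin k),
    (M.rename r).rename r' = M.rename (r' ∘ r) := by
  have lift : ∀ {n m k : ℕ} (r : Fin n → Fin m) (r' : Fin m → Fin k),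
      liftRen r' ∘ liftRen r = liftRen (r' ∘ r) :=
    fun r r' => funext fun i => Fin.cases rfl (fun _ => rfl) i
  induction M <;> intro m k r r' <;> simp only [Tm.rename, Function.comp_apply, *]

theorem Tm.subst_rename {n : ℕ} (M : Tm n) : ∀ {m k : ℕ} (r : Fin n → Fin m) (s : Fin m → Tm k),
    (M.rename r).subst s = M.subst fun i => s (r i) := by
  have lift : ∀ {n m k : ℕ} (r : Fin n → Fin m) (s : Fin m → Tm k),
      (fun i => Tm.liftSub s (liftRen r i)) = Tm.liftSub fun i => s (r i) :=
    fun r s => funext fun i => Fin.cases rfl (fun _ => rfl) i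
  induction M <;> intro m k r s <;> simp only [Tm.rename, Tm.subst, *]

theorem Tm.rename_subst {n : ℕ} (M : Tm n) : ∀ {m k : ℕ} (s : Fin n → Tm m) (r : Fin m → Fin k),
    (M.subst s).rename r = M.subst fun i => (s i).rename r := by
  have lift : ∀ {n m k : ℕ} (s : Fin n → Tm m) (r : Fin m → Fin k),
      (fun i => (Tm.liftSub s i).rename (liftRen r)) = Tm.liftSub fun i => (s i).rename r := by
    refine fun s r => funext fun i => Fin.cases rfl (fun i => ?_) i
    change ((s i).rename Fin.succ).rename _ = ((s i).rename r).rename Fin.succ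
    rw [Tm.rename_rename, Tm.rename_rename]
    rfl
  induction M <;> intro m k s r <;> simp only [Tm.rename, Tm.subst, *]

theorem Tm.subst_subst {n : ℕ} (M : Tm n) : ∀ {m k : ℕ} (s : Fin n → Tm m) (t : Fin m → Tm k),
    (M.subst s).subst t = M.subst fun i => (s i).subst t := by
  have lift : ∀ {n m k : ℕ} (s : Fin n → Tm m) (t : Fin m → Tm k),
      (fun i => (Tm.liftSub s i).subst (Tm.liftSub t)) = Tm.liftSub fun i => (s i).subst t := by
    refine fun s t => funext fun i => Fin.cases rfl (fun i => ?_) i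
    change ((s i).rename Fin.succ).subst _ = ((s i).subst t).rename Fin.succ
    rw [Tm.subst_rename, Tm.rename_subst]
    rfl
  induction M <;> intro m k s t <;> simp only [Tm.subst, *]

theorem Tm.subst_var {n : ℕ} (M : Tm n) : M.subst Tm.var = M := by
  have lift : ∀ {n : ℕ}, Tm.liftSub (Tm.var (n := n)) = Tm.var :=
    funext fun i => Fin.cases rfl (fun _ => rfl) i
  induction M <;> simp only [Tm.subst, *]

theorem Tm.inst_subst_liftSub {n m : ℕ} (M : Tm (n + 1)) (s : Fin n → Tm m) (N : Tm m) :
    (M.subst (Tm.liftSub s)).inst N = M.subst (Fin.cases N s) := by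
  unfold Tm.inst
  rw [Tm.subst_subst]
  congr 1
  refine funext fun i => Fin.cases rfl (fun i => ?_) i
  change ((s i).rename Fin.succ).subst _ = s i
  rw [Tm.subst_rename]
  exact Tm.subst_var _

/-! ## Adequacy -/

/-- The fundamental lemma of the logical relation. -/
theorem Typing.rel {m : ℕ} {Γ : Ctx m} {M : Tm m} {σ : Ty 0} (d : Typing Γ M σ) :
    ∀ {n : ℕ} {γ : Γ.den.obj n} {s : Fin m → Tm 0}, (∀ i, Rel n (Γ i) (γ i) (s i)) →
      Rel n σ (d.den.app n γ) (M.subst s) := by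
  have resTo : ∀ {m : ℕ} {Γ : Ctx m} {k n : ℕ} (h : k ≤ n) {γ : Γ.den.obj n} {s : Fin m → Tm 0},
      (∀ i, Rel n (Γ i) (γ i) (s i)) → ∀ i, Rel k (Γ i) (Γ.den.resTo h γ i) (s i) := by
    intro m Γ k n h γ s hs
    induction n, h using Nat.le_induction with
    | base => rwa [TT.resTo_self]
    | succ n h ih =>
      rw [← TT.resTo_res _ h]
      exact ih fun i => (hs i).res
  have inst : ∀ {m : ℕ} {Γ : Ctx m} {σ τ : Ty 0} {M : Tm (m + 1)} {d : Typing (Γ.cons σ) M τ}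
      (_ : ∀ {n : ℕ} {γ : (Γ.cons σ).den.obj n} {s : Fin (m + 1) → Tm 0},
        (∀ i, Rel n ((Γ.cons σ) i) (γ i) (s i)) → Rel n τ (d.den.app n γ) (M.subst s))
      {n : ℕ} {γ : Γ.den.obj n} {s : Fin m → Tm 0} (_ : ∀ i, Rel n (Γ i) (γ i) (s i))
      (k : ℕ) (h : k ≤ n) (x : σ.den.obj k) (N : Tm 0), Rel k σ x N →
      Rel k τ (((extend Γ σ).comp d.den).app k (Γ.den.resTo h γ, x))
        ((M.subst (Tm.liftSub s)).inst N) := by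
    intro m Γ σ τ M d ih n γ s hs k h x N hx
    rw [Tm.inst_subst_liftSub]
    exact ih fun i => Fin.cases hx (resTo h hs) i
  induction d with
  | var i => exact fun hs => hs i
  | unit => exact fun _ => Rel.one_now.mpr (.refl _)
  | lam d ih =>
    exact fun hs => Rel.arrow.mpr fun k h x N hx => (inst ih hs k h x N hx).of_red (.beta _ _ _)
  | app d d₁ ih ih₁ => exact fun hs => Rel.arrow.mp (ih hs) _ le_rfl _ _ (ih₁ hs)
  | inl d ih => exact fun hs => Rel.sum_inl.mpr ⟨_, .refl _, ih hs⟩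
  | inr d ih => exact fun hs => Rel.sum_inr.mpr ⟨_, .refl _, ih hs⟩
  | case d d₁ d₂ ih ih₁ ih₂ => exact fun hs => Rel.hat (inst ih₁ hs) (inst ih₂ hs) (ih hs)
  | fst d ih => exact fun hs => (Rel.prod.mp (ih hs)).1
  | snd d ih => exact fun hs => (Rel.prod.mp (ih hs)).2
  | pair d d₁ ih ih₁ =>
    exact fun hs => Rel.prod.mpr ⟨(ih hs).of_red (.fstPair _ _), (ih₁ hs).of_red (.sndPair _ _)⟩
  | unfold d ih => exact fun hs => Rel.tick (Rel.mu.mp (ih hs))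
  | fold d ih =>
    intro n γ s hs
    refine Rel.mu.mpr ((congrArg (fun x => LaterRel n _ x _) ?_).mpr
      (LaterRel.next (.unfoldFold _) (ih hs)))
    exact Hom.ofEq_symm_app (den_mu _) n _

theorem Hom.iterate_apply_val {X : TT} (f : Hom X X) (x : ForallClock X) (k n : ℕ) :
    (f.apply^[k] x).val n = (f.app n)^[k] (x.val n) :=
  Function.Semiconj.iterate_right (f := fun x : ForallClock X => x.val n) (fun _ => rfl) k x

theorem Rel.red_unit {n : ℕ} : ∀ {k : ℕ} {M : Tm 0},
    Rel (n + k) .one (((delay .one).apply^[k] ((Hom.now TT.one).apply TT.star)).val (n + k)) M →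
      Red M k .unit
  | 0, _, h => one_now.mp h
  | k + 1, M, h => by
    let z : ForallClock (Ty.den .one) := (delay .one).apply^[k] ((Hom.now TT.one).apply TT.star)
    have hz := (congrArg (fun y : ForallClock (Ty.den .one) => Rel (n + (k + 1)) .one (y.val _) M)
      (Function.iterate_succ_apply' (delay .one).apply k _)).mp h
    obtain ⟨N, hN, h'⟩ := one_tickLift.mp ((congrArg (fun y => Rel (n + k + 1) .one y M)
      (tick_one (n + k + 1) ((Hom.next _).app _ (z.val _)))).mp hz)
    rw [add_comm]
    exact hN.trans (red_unit ((congrArg (fun y => Rel (n + k) .one y N) (z.compat _)).mp h'))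

end FPC

theorem mainTheorem4 (M : FPC.Tm 0) (d : FPC.Typing FPC.Ctx.nil M FPC.Ty.one) (n : ℕ) :
    FPC.BigStep M n FPC.Tm.unit ↔
      Nonempty (FPC.ForallClock (FPC.TT.eq
        (d.den.apply FPC.starNil)
        ((FPC.delay FPC.Ty.one).apply^[n] ((FPC.Hom.now FPC.TT.one).apply FPC.TT.star)))) := by
  constructor
  · intro h
    obtain ⟨v, hv⟩ := h.sound d
    cases v
    have key : ∀ m, (d.den.apply FPC.starNil).val m =
        ((FPC.delay FPC.Ty.one).apply^[n] ((FPC.Hom.now FPC.TT.one).apply FPC.TT.star)).val m :=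
      fun m => (hv m _).trans (FPC.Hom.iterate_apply_val (X := FPC.Ty.den .one) (FPC.delay .one)
        ((FPC.Hom.now FPC.TT.one).apply FPC.TT.star) n m).symm
    exact ⟨fun m => ⟨key m⟩, fun _ => rfl⟩
  · rintro ⟨h⟩
    have hM := d.rel (n := 0 + n) (γ := FPC.starNil.val (0 + n)) (s := Fin.elim0) fun i => i.elim0
    have hs : (Fin.elim0 : Fin 0 → FPC.Tm 0) = FPC.Tm.var := funext fun i => i.elim0
    rw [hs, FPC.Tm.subst_var] at hM
    exact FPC.BigStep.of_red (FPC.Rel.red_unit ((congrArg (fun y => FPC.Rel (0 + n) .one y M)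
      (h.val (0 + n)).down).mp hM)) (.value .unit)
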